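/- **Setting.** Fix a finite alphabet $\mathbb A$, a countable set $\mathcal Q$ of properties (say $\mathcal Q=\mathbb N$), and a set $\Pi$ of regular expressions over $\mathbb A$ (built from the words $d\in\mathbb A^*$ by concatenation, union and star). *Trees* are the elements of the least set containing every finite multiset $\{d_1:t_1,\dots,d_n:t_n\}$, $n\ge 0$, with $d_i\in\mathbb A^*$ and $t_i$ trees. *Filters* are given by $\varphi ::= \pi\mid q\mid \varphi\wedge\varphi\mid\neg\varphi$ with $\pi\in\Pi$, $q\in\mathcal Q$; for $d\in\mathbb A^*$ and $Q\subseteq\mathcal Q$, $(d,Q)\models\pi$ iff $d$ matches $\pi$, $(d,Q)\models q$ iff $q\in Q$, and $\wedge,\neg$ are as usual. A filter is *singleton-valid* if it is satisfied by all $(d,Q)$ with $|Q|\le 1$. A *horizontal automaton* $H$ consists of a finite set $P$ of horizontal states and a finite set of transitions $p\xrightarrow{\varphi}p'$ with $p,p'\in P$ and $\varphi$ a filter. It rewrites pairs of a state and a finite multiset over $\mathbb A^*\times 2^{\mathcal Q}$: $(p,M+\{d:Q\})\to(p',M)$ if there is a transition $p\xrightarrow{\varphi}p'$ with $(d,Q)\models\varphi$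 (one says that $p$ *can read* $(d,Q)$). $H$ is *confluent* if the relation obtained from $\to$ by adding $(p,M)\to\bot$ whenever $M\neq\emptyset$ and $(p,M)$ has no $\to$-successor is confluent. An *AUTC* $A$ consists of a confluent horizontal automaton $H$, an initial state $p_0\in P$, a finite set $S\subseteq\mathcal Q$ of vertical states, a set $F\subseteq S$ of final states, and a finite set of rules $(p_0,p)\to q$ with $p\in P$, $q\in S$, such that whether $(p_0,\{d_1:Q_1,\dots,d_n:Q_n\})\to^*(p,\emptyset)$ holds depends, for each rule, only on the sets $Q_i\cap S$, and such that $A$ is vertically deterministic: every tree is evaluated to at most one state. Here the evaluation of a tree is the set of states defined recursively by $$\mathrm{eval}_A\{d_1:t_1,\dots,d_n:t_n\}=\{q \mid \text{there is a rule } (p_0,p)\to q \text{ with } (p_0,\{d_1:\mathrm{eval}_A(t_1),\dots,d_n:\mathrm{eval}_A(t_n)\})\to^*(p,\emptyset)\},$$ and $L(A)=\{t\mid \mathrm{eval}_A(t)\cap F\ne\emptyset\}$. A vertical state $q$ is *accessible* if $q\in\mathrm{eval}_A(t)$ for some tree $t$, and *accepting* if $q\in F$. A horizontal state $p$ is *accessible*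 if $(p_0,M)\to^*(p,\emptyset)$ for some finite multiset $M$ of pairs $(d,\{q\})$ with $d\in\mathbb A^*$ and $q$ an accessible vertical state, and *accepting* if there is a rule $(p_0,p)\to q$ for some $q$. **Proposition (AUTC Universality).** Suppose that singleton-validity of filters is decidable in polynomial time. Then it is decidable in polynomial time, given an AUTC $A$, whether $L(A)$ is the set of all trees. (Filters and automata are written as strings in the usual way, with state names in binary, and polynomial time is that of deterministic multi-stack Turing machines, in the length of the input. Inputs are promised to be filters, respectively AUTCs.) Moreover, for every AUTC $A$, $L(A)$ is the set of all trees if and only if every accessible vertical state is accepting, every accessible horizontal state is accepting, and every accessible horizontal state can read $(d,\{q\})$ for every $d\in\mathbb A^*$ and every accessible vertical state $q$. -/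

import Mathlib

namespace DataTree

/-! ### Unordered, edge-labelled data trees -/

/-- Finite trees whose edges carry data values in `α*`, with an (irrelevant) order on the edges
below each node. -/
inductive OrdTree (α : Type) : Type
  | node (children : List (List α × OrdTree α)) : OrdTree α

/-- One reordering step: permute the edges below the root, or reorder inside one subtree. -/
inductive OrdTree.Reorder {α : Type} : OrdTree α → OrdTree α → Prop
  | perm {cs ds : List (List α × OrdTree α)} (h : cs.Perm ds) :
      OrdTree.Reorder (OrdTree.node cs) (OrdTree.node ds)
  | child {t t' : OrdTree α} (cs ds : List (List α × OrdTree α)) (d : List α)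
      (h : OrdTree.Reorder t t') :
      OrdTree.Reorder (OrdTree.node (cs ++ (d, t) :: ds)) (OrdTree.node (cs ++ (d, t') :: ds))

/-- Unordered data trees: trees up to the order of the edges below each node. The facts below
show that this is the least set closed under forming finite multisets of pairs `d : t`. -/
def Tree (α : Type) : Type := Quot (@OrdTree.Reorder α)

namespace Tree

variable {α : Type}

/-- The unordered tree of an ordered tree. -/
def mk (t : OrdTree α) : Tree α := Quot.mk _ t

/-- The multiset `{d₁ : t₁, …, dₙ : tₙ}` that a tree is. -/
def children : Tree α → Multiset (List α × Tree α) :=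
  Quot.lift
    (fun t => match t with
      | OrdTree.node cs => ((cs.map fun c => (c.1, mk c.2) : List _) : Multiset _))
    (by
      intro a b h
      cases h with
      | perm h => exact Multiset.coe_eq_coe.2 (h.map _)
      | child cs ds d h =>
        have e : mk _ = mk _ := Quot.sound h
        simp [e])

/-- The tree `{d₁ : t₁, …, dₙ : tₙ}` given by a multiset of pairs of a data value and a tree. -/
noncomputable def node (M : Multiset (List α × Tree α)) : Tree α :=
  mk (OrdTree.node (M.toList.map fun c => (c.1, Quot.out c.2)))

theorem mk_out (t : Tree α) : mk (Quot.out t) = t := Quot.out_eq t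

theorem children_node (M : Multiset (List α × Tree α)) : (node M).children = M := by
  show (((M.toList.map fun c => (c.1, Quot.out c.2)).map fun c => (c.1, mk c.2) : List _) :
    Multiset _) = M
  rw [List.map_map]
  have : ((fun c : List α × OrdTree α => (c.1, mk c.2)) ∘
      fun c : List α × Tree α => (c.1, Quot.out c.2)) = id := by
    funext c
    simp [mk_out]
  rw [this, List.map_id, Multiset.coe_toList]

theorem mk_node_replace (cs ds : List (List α × OrdTree α)) (d : List α) {t t' : OrdTree α}
    (h : mk t = mk t') :
    mk (OrdTree.node (cs ++ (d, t) :: ds)) = mk (OrdTree.node (cs ++ (d, t') :: ds)) := by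
  have h' := Quot.eqvGen_exact h
  clear h
  induction h' with
  | rel x y hxy => exact Quot.sound (OrdTree.Reorder.child cs ds d hxy)
  | refl x => rfl
  | symm x y _ ih => exact ih.symm
  | trans x y z _ _ ih1 ih2 => exact ih1.trans ih2

theorem mk_node_congr {ds es : List (List α × OrdTree α)}
    (h : List.Forall₂ (fun c e => c.1 = e.1 ∧ mk c.2 = mk e.2) ds es) :
    ∀ cs : List (List α × OrdTree α),
      mk (OrdTree.node (cs ++ ds)) = mk (OrdTree.node (cs ++ es)) := by
  induction h with
  | nil => intro cs; rfl
  | @cons c e ds es hce _ ih =>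
    intro cs
    obtain ⟨d, t⟩ := c
    obtain ⟨d', t'⟩ := e
    obtain ⟨h1, h2⟩ := hce
    simp only at h1 h2
    subst h1
    rw [mk_node_replace cs ds d h2]
    simpa using ih (cs ++ [(d, t')])

theorem mk_node (cs : List (List α × OrdTree α)) :
    mk (OrdTree.node cs) =
      node ((cs.map fun c => (c.1, mk c.2) : List (List α × Tree α)) : Multiset (List α × Tree α)) := by
  set M : Multiset (List α × Tree α) :=
    ((cs.map fun c => (c.1, mk c.2) : List (List α × Tree α)) : Multiset (List α × Tree α))
    with hM
  have hp : M.toList.Perm (cs.map fun c => (c.1, mk c.2)) := by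
    rw [← Multiset.coe_eq_coe, Multiset.coe_toList]
  have h1 : mk (OrdTree.node (M.toList.map fun c => (c.1, Quot.out c.2))) =
      mk (OrdTree.node ((cs.map fun c => (c.1, mk c.2)).map fun c => (c.1, Quot.out c.2))) :=
    Quot.sound (OrdTree.Reorder.perm (hp.map _))
  have h2 := mk_node_congr (ds := cs)
    (es := (cs.map fun c => (c.1, mk c.2)).map fun c => (c.1, Quot.out c.2)) (by
      rw [List.map_map, List.forall₂_map_right_iff]
      apply List.forall₂_same.2
      intro c _
      exact ⟨rfl, (mk_out _).symm⟩) []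
  exact h2.trans h1.symm

theorem node_children (t : Tree α) : node t.children = t := by
  induction t using Quot.ind with
  | mk t =>
    cases t with
    | node cs => exact (mk_node cs).symm

/-- Induction over trees: every tree is built from multisets of trees. -/
theorem induction {p : Tree α → Prop}
    (h : ∀ M : Multiset (List α × Tree α), (∀ c ∈ M, p c.2) → p (node M)) (t : Tree α) : p t := by
  have key : ∀ t : OrdTree α, p (mk t) := by
    intro t
    induction t using OrdTree.rec (motive_2 := fun l => ∀ c ∈ l, p (mk c.2))
      (motive_3 := fun c => p (mk c.2)) with
    | node cs ih =>
      rw [mk_node]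
      apply h
      intro c hc
      simp only [Multiset.mem_coe, List.mem_map] at hc
      obtain ⟨c', hc', rfl⟩ := hc
      exact ih c' hc'
    | nil => rename_i c hc; simp at hc
    | cons a l iha ihl =>
      rename_i c hc
      rcases List.mem_cons.1 hc with rfl | hc
      · exact iha
      · exact ihl c hc
    | mk d t ih => exact ih
  induction t using Quot.ind with
  | mk t => exact key t

end Tree

/-! ### Descriptor classes and automata for unordered trees

The countable set of properties is `ℕ`. Sizes are accounted for by the encodings below. -/

/-- A descriptor class: descriptors together with their satisfaction relation. -/
structure DescriptorClass (X : Type) where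
  /-- the descriptors -/
  Desc : Type
  /-- `Sat x h` means that the model `x` satisfies the descriptor `h` -/
  Sat : X → Desc → Prop

/-- The subclass given by a set of descriptors. -/
abbrev DescriptorClass.restrict {X : Type} (D : DescriptorClass X) (S : Set D.Desc) :
    DescriptorClass X where
  Desc := {h : D.Desc // h ∈ S}
  Sat x h := D.Sat x h.1

/-- Arities decorated with sets of properties, `{d₁ : Q₁, …, dₙ : Qₙ}`. -/
abbrev Arity (α : Type) : Type := Multiset (List α × Set ℕ)

/-- Horizontal descriptor classes over the data alphabet `α`. -/
abbrev HDescriptorClass (α : Type) : Type 1 := DescriptorClass (Arity α)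

/-- Satisfaction of `h` by `{d₁ : Q₁, …, dₙ : Qₙ}` depends only on the sets `Qᵢ ∩ S`. -/
def HDescriptorClass.DependsOnlyOn {α : Type} (D : HDescriptorClass α) (h : D.Desc)
    (S : Set ℕ) : Prop :=
  ∀ l : List (List α × Set ℕ × Set ℕ), (∀ x ∈ l, x.2.1 ∩ S = x.2.2 ∩ S) →
    (D.Sat (l.map fun x => (x.1, x.2.1) : List (List α × Set ℕ)) h ↔
      D.Sat (l.map fun x => (x.1, x.2.2) : List (List α × Set ℕ)) h)

/-- The support of a horizontal descriptor: the least set of properties it depends on. -/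
def HDescriptorClass.support {α : Type} (D : HDescriptorClass α) (h : D.Desc) : Set ℕ :=
  ⋂₀ {S | HDescriptorClass.DependsOnlyOn D h S}

/-- Alternating bottom-up automata for unordered trees, with horizontal descriptors in `D`.
Finite sets are presented as lists. -/
structure AUT {α : Type} (D : HDescriptorClass α) where
  /-- the vertical states -/
  states : List ℕ
  /-- the final states -/
  finals : List ℕ
  finals_subset : ∀ q ∈ finals, q ∈ states
  /-- the rules `h → q` -/
  rules : List (D.Desc × ℕ)
  rules_target : ∀ r ∈ rules, r.2 ∈ states
  rules_support : ∀ r ∈ rules, HDescriptorClass.support D r.1 ⊆ {q | q ∈ states}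

namespace AUT

variable {α : Type} {D : HDescriptorClass α}

/-- The states assigned to a node whose decorated arity is `M`. -/
def fire (A : AUT D) (M : Arity α) : Set ℕ := {q | ∃ h, (h, q) ∈ A.rules ∧ D.Sat M h}

/-- Evaluation, on ordered representatives. -/
def evalOrd (A : AUT D) : OrdTree α → Set ℕ
  | OrdTree.node cs =>
    A.fire ((cs.attach.map fun c => (c.1.1, evalOrd A c.1.2) : List _) : Multiset _)
termination_by t => sizeOf t
decreasing_by
  have h := List.sizeOf_lt_of_mem c.2
  have h' : sizeOf c.1 = 1 + sizeOf c.1.1 + sizeOf c.1.2 := by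
    rcases c with ⟨⟨a, b⟩, _⟩; rfl
  simp only [OrdTree.node.sizeOf_spec]
  omega

theorem evalOrd_node (A : AUT D) (cs : List (List α × OrdTree α)) :
    A.evalOrd (OrdTree.node cs) =
      A.fire ((cs.map fun c => (c.1, A.evalOrd c.2) : List _) : Multiset _) := by
  rw [evalOrd]
  congr 2
  have h := congrArg (List.map fun c : List α × OrdTree α => (c.1, A.evalOrd c.2))
    (List.attach_map_subtype_val cs)
  rw [List.map_map] at h
  exact h

theorem evalOrd_reorder (A : AUT D) {t t' : OrdTree α} (h : OrdTree.Reorder t t') :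
    A.evalOrd t = A.evalOrd t' := by
  induction h with
  | perm h =>
    rw [evalOrd_node, evalOrd_node]
    congr 1
    exact Multiset.coe_eq_coe.2 (h.map _)
  | child cs ds d h ih =>
    rw [evalOrd_node, evalOrd_node]
    simp [ih]

/-- The set of states to which the automaton evaluates a tree. -/
def eval (A : AUT D) : Tree α → Set ℕ :=
  Quot.lift A.evalOrd fun _ _ h => A.evalOrd_reorder h

/-- The defining equation of evaluation: `q` is assigned to `{d₁ : t₁, …, dₙ : tₙ}` iff there is
a rule `h → q` such that `{d₁ : eval t₁, …, dₙ : eval tₙ}` satisfies `h`. -/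
theorem eval_node (A : AUT D) (M : Multiset (List α × Tree α)) :
    A.eval (Tree.node M) =
      {q | ∃ h, (h, q) ∈ A.rules ∧ D.Sat (M.map fun c => (c.1, A.eval c.2)) h} := by
  show A.evalOrd (OrdTree.node _) = A.fire _
  rw [evalOrd_node, List.map_map]
  congr 1
  have : ((fun c : List α × OrdTree α => (c.1, A.evalOrd c.2)) ∘
      fun c : List α × Tree α => (c.1, Quot.out c.2)) = fun c => (c.1, A.eval c.2) := by
    funext c
    show (c.1, A.eval (Tree.mk (Quot.out c.2))) = _
    rw [Tree.mk_out]
  rw [this, ← Multiset.map_coe, Multiset.coe_toList]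

/-- The language of the automaton. -/
def language (A : AUT D) : Set (Tree α) := {t | (A.eval t ∩ {q | q ∈ A.finals}).Nonempty}

/-- Vertical determinism: every tree is evaluated to at most one state. -/
def VerticallyDeterministic (A : AUT D) : Prop := ∀ t : Tree α, (A.eval t).Subsingleton

end AUT

/-! ### Patterns and filters -/

/-- Regular expressions over `α`, with data values as atoms. -/
inductive Pattern (α : Type) : Type
  | word (d : List α) : Pattern α
  | cat (x y : Pattern α) : Pattern α
  | alt (x y : Pattern α) : Pattern α
  | star (x : Pattern α) : Pattern α

/-- The set of data values matched by a pattern. -/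
def Pattern.sem {α : Type} : Pattern α → Language α
  | Pattern.word d => ({d} : Set (List α))
  | Pattern.cat x y => x.sem * y.sem
  | Pattern.alt x y => x.sem + y.sem
  | Pattern.star x => KStar.kstar x.sem

/-- Filters: Boolean combinations of properties and of patterns from the class `P`. -/
inductive Filt {α : Type} (P : Set (Pattern α)) : Type
  | pat (x : P) : Filt P
  | state (q : ℕ) : Filt P
  | and (f g : Filt P) : Filt P
  | not (f : Filt P) : Filt P

/-- Satisfaction of a filter by a pair of a data value and a set of properties. -/
def Filt.Sat {α : Type} {P : Set (Pattern α)} (d : List α) (Q : Set ℕ) : Filt P → Prop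
  | Filt.pat x => d ∈ x.1.sem
  | Filt.state q => q ∈ Q
  | Filt.and f g => f.Sat d Q ∧ g.Sat d Q
  | Filt.not f => ¬ f.Sat d Q

/-- Singleton-validity: the filter holds for all `(d, Q)` with `Q` empty or a singleton. -/
def Filt.SingletonValid {α : Type} {P : Set (Pattern α)} (f : Filt P) : Prop :=
  ∀ (d : List α) (Q : Set ℕ), Q.Subsingleton → f.Sat d Q

/-! ### Horizontal automata and confluence -/

/-- Horizontal automata with filters over the pattern class `P`. Finite sets are presented as
lists; states are named by natural numbers. -/
structure HorAut {α : Type} (P : Set (Pattern α)) where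
  /-- the horizontal states -/
  states : List ℕ
  /-- the horizontal transitions -/
  rules : List ({p : ℕ // p ∈ states} × Filt P × {p : ℕ // p ∈ states})

namespace HorAut

variable {α : Type} {P : Set (Pattern α)}

/-- The horizontal states, as a type. -/
abbrev State (H : HorAut P) : Type := {p : ℕ // p ∈ H.states}

/-- In state `p` one can read `(d, Q)` and go to state `p'`. -/
def Reads (H : HorAut P) (p : H.State) (d : List α) (Q : Set ℕ) (p' : H.State) : Prop :=
  ∃ f : Filt P, (p, f, p') ∈ H.rules ∧ f.Sat d Q

/-- The horizontal rewriting relation: `(p, M + {d : Q}) → (p', M)`. -/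
inductive Step (H : HorAut P) : H.State × Arity α → H.State × Arity α → Prop
  | read {p p' : H.State} (M : Arity α) {d : List α} {Q : Set ℕ} (h : H.Reads p d Q p') :
      Step H (p, M + {(d, Q)}) (p', M)

/-- The failure-extended horizontal rewriting relation, where `none` stands for failure. -/
inductive FailStep (H : HorAut P) :
    Option (H.State × Arity α) → Option (H.State × Arity α) → Prop
  | step {c c' : H.State × Arity α} (h : H.Step c c') : FailStep H (some c) (some c')
  | fail {p : H.State} {M : Arity α} (hM : M ≠ 0) (h : ¬ ∃ c', H.Step (p, M) c') :
      FailStep H (some (p, M)) none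

/-- A horizontal automaton is confluent if its failure-extended rewriting relation is. -/
def Confluent (H : HorAut P) : Prop :=
  ∀ x y z : Option (H.State × Arity α),
    Relation.ReflTransGen H.FailStep x y → Relation.ReflTransGen H.FailStep x z →
      ∃ w, Relation.ReflTransGen H.FailStep y w ∧ Relation.ReflTransGen H.FailStep z w

/-- The descriptor class of a horizontal automaton: pairs `(p, p')` of states, satisfied by `M`
if `p'` can be reached from `p` while consuming `M`. -/
abbrev descriptorClass (H : HorAut P) : HDescriptorClass α where
  Desc := H.State × H.State
  Sat M h := Relation.ReflTransGen H.Step (h.1, M) (h.2, 0)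

/-- The subclass of the descriptors with initial state `p₀`. -/
abbrev descriptorClassFrom (H : HorAut P) (p₀ : H.State) : HDescriptorClass α :=
  H.descriptorClass.restrict {h | h.1 = p₀}

end HorAut

/-- A vertically deterministic automaton over the descriptors with a fixed initial state `p₀` of
a confluent horizontal automaton `H`, with filters over the pattern class `P`. -/
structure AUTC {α : Type} (P : Set (Pattern α)) where
  /-- the horizontal automaton -/
  H : HorAut P
  /-- the initial horizontal state -/
  p₀ : H.State
  /-- the vertical automaton -/
  aut : AUT (H.descriptorClassFrom p₀)
  confluent : H.Confluent
  deterministic : aut.VerticallyDeterministic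

namespace AUTC

variable {α : Type} {P : Set (Pattern α)}

/-- The language of the automaton. -/
def language (A : AUTC P) : Set (Tree α) := A.aut.language

/-- A vertical state is accessible if some tree is evaluated to it. -/
def VAccessible (A : AUTC P) (q : ℕ) : Prop := ∃ t : Tree α, q ∈ A.aut.eval t

/-- A horizontal state is accessible if it can be reached from the initial one by reading pairs
`(d, {q})` with `q` accessible. -/
def HAccessible (A : AUTC P) (p : A.H.State) : Prop :=
  ∃ M : Arity α, (∀ x ∈ M, ∃ q, A.VAccessible q ∧ x.2 = {q}) ∧
    Relation.ReflTransGen A.H.Step (A.p₀, M) (p, 0)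

/-- A horizontal state `p` is accepting if there is a vertical rule `(p₀, p) → q`. -/
def HAccepting (A : AUTC P) (p : A.H.State) : Prop := ∃ r ∈ A.aut.rules, r.1.1.2 = p

end AUTC

/-! ### Encodings as strings, and polynomial time -/

/-- The finite alphabet of the encodings. -/
inductive Sym (α : Type) : Type
  | bit (b : Bool) : Sym α
  | letter (a : α) : Sym α
  | word : Sym α
  | cat : Sym α
  | alt : Sym α
  | star : Sym α
  | state : Sym α
  | and : Sym α
  | not : Sym α
  | sep : Sym α
  | close : Sym α

/-- Names of states are written in binary. -/
def encodeName {α : Type} (n : ℕ) : List (Sym α) := (Computability.encodeNat n).map Sym.bit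

/-- Patterns in Polish notation. -/
def Pattern.encode {α : Type} : Pattern α → List (Sym α)
  | Pattern.word d => Sym.word :: d.map Sym.letter
  | Pattern.cat x y => Sym.cat :: (x.encode ++ y.encode)
  | Pattern.alt x y => Sym.alt :: (x.encode ++ y.encode)
  | Pattern.star x => Sym.star :: x.encode

/-- Filters in Polish notation. -/
def Filt.encode {α : Type} {P : Set (Pattern α)} : Filt P → List (Sym α)
  | Filt.pat x => x.1.encode
  | Filt.state q => Sym.state :: encodeName q
  | Filt.and f g => Sym.and :: (f.encode ++ g.encode)
  | Filt.not f => Sym.not :: f.encode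

/-- A name followed by a separator. -/
def encodeItem {α : Type} (n : ℕ) : List (Sym α) := encodeName n ++ [Sym.sep]

/-- An automaton is written as the lists of its vertical states, of its final states, of its
horizontal states and of its horizontal transitions, its initial horizontal state `p₀`, and the
list of its vertical rules `(p₀, p) → q`, written `p, q`. -/
def AUTC.encode {α : Type} {P : Set (Pattern α)} (A : AUTC P) : List (Sym α) :=
  A.aut.states.flatMap encodeItem ++ [Sym.close] ++
  A.aut.finals.flatMap encodeItem ++ [Sym.close] ++
  A.H.states.flatMap encodeItem ++ [Sym.close] ++
  A.H.rules.flatMap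
    (fun r => encodeItem r.1.1 ++ r.2.1.encode ++ [Sym.sep] ++ encodeItem r.2.2.1) ++
  [Sym.close] ++
  encodeItem A.p₀.1 ++
  A.aut.rules.flatMap (fun r => encodeItem r.1.1.2.1 ++ encodeItem r.2) ++ [Sym.close]

open Classical in
/-- The decision problem `p` on the instances `a : I`, written as strings by `enc`, is decided by
a Turing machine in time polynomial in the length of the input. -/
def DecidableInPTime {I Γ : Type} (enc : I → List Γ) (p : I → Prop) : Prop :=
  Nonempty (Turing.TM2ComputableInPolyTime enc Computability.encodeBool fun a => decide (p a))

end DataTree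

/-! Confluence makes a failed reading and a successful one incompatible, and likewise two successful
readings that end in different states; together with vertical determinism this shows that in an
automaton that accepts every tree the accessible states are accepting and never get stuck.
Conversely, by induction on trees, every tree evaluates to a final state as soon as some set of
horizontal states contains the initial one, is closed under reading the vertical states that it
fires, never gets stuck on them, and is accepting.

The accessible states form such a set if there is one at all, and they are found by saturation.
Each round asks whether some word satisfies a filter together with `{q}`, and the final test asks
whether the filters `φ₁, …, φₙ` on the transitions that leave a state cover all `(d, {q})`. Both are
questions about singleton-validity, since the latter says that `¬ (¬ φ₁ ∧ … ∧ ¬ φₙ ∧ q)` is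
singleton-valid. For the time bound, string functions that are computed by structured programs on
finitely many stacks are closed under the operations that the saturation needs, and such programs
compile into Turing machines which run the machine for singleton-validity as a subroutine. -/

namespace DataTree

namespace HorAut

variable {α : Type} {P : Set (Pattern α)} {H : HorAut P}

theorem Step.add_right {c c' : H.State × Arity α} (h : H.Step c c') (N : Arity α) :
    H.Step (c.1, c.2 + N) (c'.1, c'.2 + N) := by
  obtain ⟨M, hr⟩ := h
  simpa only [add_right_comm] using Step.read (M + N) hr

theorem reflTransGen_step_add_right {c c' : H.State × Arity α}
    (h : Relation.ReflTransGen H.Step c c') (N : Arity α) :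
    Relation.ReflTransGen H.Step (c.1, c.2 + N) (c'.1, c'.2 + N) :=
  h.lift (fun c => (c.1, c.2 + N)) fun _ _ h => h.add_right N

theorem reflTransGen_step_concat {p p' p'' : H.State} {M : Arity α} {d : List α} {Q : Set ℕ}
    (h : Relation.ReflTransGen H.Step (p, M) (p', 0)) (hr : H.Reads p' d Q p'') :
    Relation.ReflTransGen H.Step (p, M + {(d, Q)}) (p'', 0) :=
  (reflTransGen_step_add_right h {(d, Q)}).tail (.read 0 hr)

theorem exists_reads_of_step {p : H.State} {x : List α × Set ℕ} {c : H.State × Arity α}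
    (h : H.Step (p, {x}) c) : ∃ p', H.Reads p x.1 x.2 p' := by
  generalize hy : (p, ({x} : Arity α)) = y at h
  obtain @⟨_, p', M, d, Q, hr⟩ := h
  obtain ⟨rfl, hM⟩ := Prod.mk.inj hy
  have hx : (d, Q) = x := Multiset.mem_singleton.1 (by simp [hM])
  exact ⟨p', hx ▸ hr⟩

theorem not_step_zero {p : H.State} {c : H.State × Arity α} : ¬ H.Step (p, 0) c := by
  generalize hx : (p, (0 : Arity α)) = x
  rintro ⟨M, hr⟩
  simpa using congrArg Multiset.card (Prod.mk.inj hx).2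

theorem reflTransGen_failStep {c c' : H.State × Arity α}
    (h : Relation.ReflTransGen H.Step c c') :
    Relation.ReflTransGen H.FailStep (some c) (some c') :=
  h.lift some fun _ _ => .step

theorem eq_of_reflTransGen_failStep_zero {p : H.State} {y : Option (H.State × Arity α)}
    (h : Relation.ReflTransGen H.FailStep (some (p, 0)) y) : y = some (p, 0) := by
  rcases h.cases_head with h | ⟨z, hz, -⟩
  · exact h.symm
  · cases hz with
    | step h => exact absurd h not_step_zero
    | fail hM _ => exact absurd rfl hM

theorem eq_of_reflTransGen_failStep_none {y : Option (H.State × Arity α)}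
    (h : Relation.ReflTransGen H.FailStep none y) : y = none := by
  rcases h.cases_head with h | ⟨z, ⟨⟩, -⟩
  exact h.symm

theorem Confluent.eq_of_consume (hH : H.Confluent) {c : H.State × Arity α} {p p' : H.State}
    (h : Relation.ReflTransGen H.Step c (p, 0)) (h' : Relation.ReflTransGen H.Step c (p', 0)) :
    p = p' := by
  obtain ⟨w, h₁, h₂⟩ := hH _ _ _ (reflTransGen_failStep h) (reflTransGen_failStep h')
  simpa using (eq_of_reflTransGen_failStep_zero h₁).symm.trans (eq_of_reflTransGen_failStep_zero h₂)

theorem Confluent.exists_reads (hH : H.Confluent) {c : H.State × Arity α} {p p' : H.State}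
    {x : List α × Set ℕ} (h : Relation.ReflTransGen H.Step c (p, {x}))
    (h' : Relation.ReflTransGen H.Step c (p', 0)) : ∃ p'', H.Reads p x.1 x.2 p'' := by
  by_contra hn
  have hfail : H.FailStep (some (p, {x})) none :=
    .fail (Multiset.singleton_ne_zero _) fun ⟨_, hc⟩ => hn (exists_reads_of_step hc)
  obtain ⟨w, h₁, h₂⟩ := hH _ _ _ ((reflTransGen_failStep h).tail hfail) (reflTransGen_failStep h')
  simpa using (eq_of_reflTransGen_failStep_none h₁).symm.trans (eq_of_reflTransGen_failStep_zero h₂)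

end HorAut

namespace AUTC

variable {α : Type} {P : Set (Pattern α)} {A : AUTC P}

theorem eval_eq_singleton {t : Tree α} {q : ℕ} (h : q ∈ A.aut.eval t) : A.aut.eval t = {q} :=
  (A.deterministic t).eq_singleton_of_mem h

theorem mem_eval_node {N : Multiset (List α × Tree α)} {q : ℕ} :
    q ∈ A.aut.eval (Tree.node N) ↔ ∃ r ∈ A.aut.rules, r.2 = q ∧
      Relation.ReflTransGen A.H.Step (A.p₀, N.map fun c => (c.1, A.aut.eval c.2)) (r.1.1.2, 0) := by
  rw [AUT.eval_node]
  constructor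
  · rintro ⟨⟨⟨p, p'⟩, rfl : p = A.p₀⟩, hr, hs⟩
    exact ⟨_, hr, rfl, hs⟩
  · rintro ⟨⟨⟨⟨p, p'⟩, rfl : p = A.p₀⟩, q⟩, hr, rfl, hs⟩
    exact ⟨_, hr, hs⟩

/-- All decorations of the arity `M` are singletons of states in `V`. -/
def SingletonsIn (V : Set ℕ) (M : Arity α) : Prop := ∀ x ∈ M, ∃ q ∈ V, x.2 = {q}

/-- The vertical states `q` of the rules `(p₀, p) → q` with `p ∈ G`. -/
def targets (A : AUTC P) (G : Set A.H.State) : Set ℕ :=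
  {q | ∃ r ∈ A.aut.rules, r.1.1.2 ∈ G ∧ r.2 = q}

theorem SingletonsIn.cons {V : Set ℕ} {M : Arity α} (hM : SingletonsIn V M) {d : List α} {q : ℕ}
    (hq : q ∈ V) : SingletonsIn V ((d, {q}) ::ₘ M) :=
  Multiset.forall_mem_cons.2 ⟨⟨q, hq, rfl⟩, hM⟩

theorem SingletonsIn.exists_eval {M : Arity α} (hM : SingletonsIn {q | A.VAccessible q} M) :
    ∃ N : Multiset (List α × Tree α), N.map (fun c => (c.1, A.aut.eval c.2)) = M := by
  induction M using Multiset.induction_on with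
  | empty => exact ⟨0, rfl⟩
  | cons x M ih =>
    obtain ⟨⟨q, ⟨t, ht⟩, hx⟩, hM⟩ := Multiset.forall_mem_cons.1 hM
    obtain ⟨N, rfl⟩ := ih hM
    exact ⟨(x.1, t) ::ₘ N, by rw [Multiset.map_cons, eval_eq_singleton ht, ← hx]⟩

theorem hAccessible_init : A.HAccessible A.p₀ := ⟨0, by simp, .refl⟩

theorem HAccessible.read {p p' : A.H.State} (hp : A.HAccessible p) {d : List α} {q : ℕ}
    (hq : A.VAccessible q) (h : A.H.Reads p d {q} p') : A.HAccessible p' := by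
  obtain ⟨M, hM, hs⟩ := hp
  refine ⟨(d, {q}) ::ₘ M, SingletonsIn.cons (V := {q | A.VAccessible q}) hM hq, ?_⟩
  simpa only [← Multiset.singleton_add, add_comm] using HorAut.reflTransGen_step_concat hs h

theorem targets_subset_vAccessible {G : Set A.H.State} (hG : ∀ p ∈ G, A.HAccessible p) :
    A.targets G ⊆ {q | A.VAccessible q} := by
  rintro _ ⟨r, hr, hp, rfl⟩
  obtain ⟨M, hM, hs⟩ := hG _ hp
  obtain ⟨N, rfl⟩ := SingletonsIn.exists_eval hM
  exact ⟨Tree.node N, mem_eval_node.2 ⟨r, hr, rfl, hs⟩⟩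

section Universal

variable (hu : A.language = Set.univ)
include hu

theorem mem_finals_of_language_eq_univ {q : ℕ} (hq : A.VAccessible q) : q ∈ A.aut.finals := by
  obtain ⟨t, ht⟩ := hq
  obtain ⟨q', hq', hf⟩ : t ∈ A.language := hu ▸ Set.mem_univ t
  exact A.deterministic t ht hq' ▸ hf

theorem exists_consume_of_language_eq_univ {M : Arity α}
    (hM : SingletonsIn {q | A.VAccessible q} M) :
    ∃ r ∈ A.aut.rules, Relation.ReflTransGen A.H.Step (A.p₀, M) (r.1.1.2, 0) := by
  obtain ⟨N, rfl⟩ := hM.exists_eval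
  obtain ⟨q, hq, -⟩ : Tree.node N ∈ A.language := hu ▸ Set.mem_univ _
  obtain ⟨r, hr, -, hs⟩ := mem_eval_node.1 hq
  exact ⟨r, hr, hs⟩

theorem HAccessible.hAccepting_of_language_eq_univ {p : A.H.State} (hp : A.HAccessible p) :
    A.HAccepting p := by
  obtain ⟨M, hM, hs⟩ := hp
  obtain ⟨r, hr, hs'⟩ := exists_consume_of_language_eq_univ hu hM
  exact ⟨r, hr, A.confluent.eq_of_consume hs' hs⟩

theorem HAccessible.exists_reads_of_language_eq_univ {p : A.H.State} (hp : A.HAccessible p)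
    (d : List α) {q : ℕ} (hq : A.VAccessible q) : ∃ p', A.H.Reads p d {q} p' := by
  obtain ⟨M, hM, hs⟩ := hp
  obtain ⟨r, -, hs'⟩ := exists_consume_of_language_eq_univ hu
    (SingletonsIn.cons (V := {q | A.VAccessible q}) hM (d := d) hq)
  refine A.confluent.exists_reads (x := (d, {q})) ?_ hs'
  simpa only [zero_add, add_comm M, Multiset.singleton_add] using
    HorAut.reflTransGen_step_add_right hs {(d, {q})}

end Universal

section Closed

variable {G : Set A.H.State}
  (hread : ∀ p ∈ G, ∀ d, ∀ q ∈ A.targets G, ∀ p', A.H.Reads p d {q} p' → p' ∈ G)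
  (hreads : ∀ p ∈ G, ∀ d, ∀ q ∈ A.targets G, ∃ p', A.H.Reads p d {q} p')
include hread hreads

theorem exists_consume_of_closed {M : Arity α} (hM : SingletonsIn (A.targets G) M) {p : A.H.State}
    (hp : p ∈ G) : ∃ p' ∈ G, Relation.ReflTransGen A.H.Step (p, M) (p', 0) := by
  induction M using Multiset.induction_on generalizing p with
  | empty => exact ⟨p, hp, .refl⟩
  | cons x M ih =>
    obtain ⟨d, Q⟩ := x
    obtain ⟨⟨q, hq, rfl : Q = {q}⟩, hM'⟩ := Multiset.forall_mem_cons.1 hM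
    obtain ⟨p', hr⟩ := hreads p hp d q hq
    obtain ⟨p'', hp'', hs⟩ := ih hM' (hread p hp d q hq p' hr)
    have hstep : A.H.Step (p, (d, {q}) ::ₘ M) (p', M) := by
      simpa only [← Multiset.singleton_add, add_comm] using HorAut.Step.read M hr
    exact ⟨p'', hp'', .head hstep hs⟩

theorem exists_mem_eval_of_closed (hinit : A.p₀ ∈ G) (hacc : ∀ p ∈ G, A.HAccepting p)
    (t : Tree α) : ∃ q ∈ A.targets G, q ∈ A.aut.eval t := by
  induction t using Tree.induction with
  | h N ih =>
    have hN : SingletonsIn (A.targets G) (N.map fun c => (c.1, A.aut.eval c.2)) := by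
      intro x hx
      obtain ⟨c, hc, rfl⟩ := Multiset.mem_map.1 hx
      obtain ⟨q, hq, ht⟩ := ih c hc
      exact ⟨q, hq, eval_eq_singleton ht⟩
    obtain ⟨p, hp, hs⟩ := exists_consume_of_closed hread hreads hN hinit
    obtain ⟨r, hr, rfl⟩ := hacc p hp
    exact ⟨r.2, ⟨r, hr, hp, rfl⟩, mem_eval_node.2 ⟨r, hr, rfl, hs⟩⟩

theorem language_eq_univ_of_closed (hinit : A.p₀ ∈ G) (hacc : ∀ p ∈ G, A.HAccepting p)
    (hfinal : ∀ q ∈ A.targets G, q ∈ A.aut.finals) : A.language = Set.univ :=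
  Set.eq_univ_of_forall fun t =>
    have ⟨q, hq, ht⟩ := exists_mem_eval_of_closed hread hreads hinit hacc t
    ⟨q, ht, hfinal q hq⟩

end Closed

theorem language_eq_univ_iff (A : AUTC P) : A.language = Set.univ ↔
    (∀ q : ℕ, A.VAccessible q → q ∈ A.aut.finals) ∧
    (∀ p : A.H.State, A.HAccessible p → A.HAccepting p) ∧
    (∀ p : A.H.State, A.HAccessible p → ∀ (d : List α) (q : ℕ), A.VAccessible q →
      ∃ p' : A.H.State, A.H.Reads p d {q} p') := by
  constructor
  · exact fun hu => ⟨fun _ => mem_finals_of_language_eq_univ hu,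
      fun _ hp => hp.hAccepting_of_language_eq_univ hu,
      fun _ hp d _ => hp.exists_reads_of_language_eq_univ hu d⟩
  · rintro ⟨hfinal, hacc, hreads⟩
    have hV := targets_subset_vAccessible (G := {p | A.HAccessible p}) fun _ => id
    exact language_eq_univ_of_closed (fun _ hp _ _ hq _ => HAccessible.read hp (hV hq))
      (fun p hp d q hq => hreads p hp d q (hV hq)) hAccessible_init hacc
      fun q hq => hfinal q (hV hq)

end AUTC

end DataTree

namespace StackProg

open Turing Function

/-- Structured programs over stacks indexed by `V` with symbols in `G`. The command `call v` passes
the reversed contents of `v` to a subroutine and replaces them by its answer: a query that has been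
pushed symbol by symbol is passed in the order in which it was pushed. -/
inductive Cmd (V G : Type) : Type
  | skip : Cmd V G
  | push (v : V) (a : G) : Cmd V G
  | pop (v : V) : Cmd V G
  | seq (c d : Cmd V G) : Cmd V G
  | case (v : V) (f : Option G → Cmd V G) : Cmd V G
  | loop (v : V) (p : Option G → Bool) (c : Cmd V G) : Cmd V G
  | call (v : V) : Cmd V G

/-- A subroutine for a decision problem: `answers w b n` says that it answers `b` to the query `w`
in `n` steps, and `symbol` is the coding of the answers by symbols. -/
structure Subroutine (G : Type) where
  symbol : Bool → G
  answers : List G → Bool → ℕ → Prop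

/-- `Exec O c S n S'`: with the subroutine `O`, the program `c` leads from the stack contents `S`
to `S'` in exactly `n` steps of the Turing machine into which it is compiled below. -/
inductive Exec {V G : Type} [DecidableEq V] (O : Subroutine G) :
    Cmd V G → (V → List G) → ℕ → (V → List G) → Prop
  | skip (S) : Exec O .skip S 1 S
  | push (v a S) : Exec O (.push v a) S 1 (update S v (a :: S v))
  | pop (v S) : Exec O (.pop v) S 1 (update S v (S v).tail)
  | seq {c d S S' S'' m n} : Exec O c S m S' → Exec O d S' n S'' → Exec O (.seq c d) S (m + n) S''
  | case {v f S S' n} : Exec O (f (S v).head?) S n S' → Exec O (.case v f) S (1 + n) S'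
  | loop_done {v p c S} : p (S v).head? = false → Exec O (.loop v p c) S 1 S
  | loop_step {v p c S S' S'' m n} : p (S v).head? = true → Exec O c S m S' →
      Exec O (.loop v p c) S' n S'' → Exec O (.loop v p c) S (1 + (m + n)) S''
  | call {v S b n} : O.answers (S v).reverse b n →
      Exec O (.call v) S ((S v).length + 1 + (n + 1)) (update S v [O.symbol b])

section Steps

variable {K : Type} [DecidableEq K] {Γ : K → Type} {Λ σ : Type} {M : Λ → TM2.Stmt Γ Λ σ}

/-- The machine `M` goes from one configuration to another in exactly `n` steps. -/
def Steps (M : Λ → TM2.Stmt Γ Λ σ) (n : ℕ) (c c' : TM2.Cfg Γ Λ σ) : Prop :=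
  (flip bind (TM2.step M))^[n] (some c) = some c'

theorem Steps.trans {m n : ℕ} {a b c : TM2.Cfg Γ Λ σ} (h : Steps M m a b) (h' : Steps M n b c) :
    Steps M (m + n) a c := by
  rw [Steps] at *
  rw [add_comm, iterate_add_apply, h, h']

theorem Steps.one (M : Λ → TM2.Stmt Γ Λ σ) (l : Λ) (v : σ) (S : ∀ k, List (Γ k)) :
    Steps M 1 ⟨some l, v, S⟩ (TM2.stepAux (M l) v S) := rfl

theorem Steps.head {n : ℕ} {l : Λ} {v : σ} {S : ∀ k, List (Γ k)} {c : TM2.Cfg Γ Λ σ}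
    (h : Steps M n (TM2.stepAux (M l) v S) c) : Steps M (1 + n) ⟨some l, v, S⟩ c :=
  (Steps.one M l v S).trans h

theorem exists_of_steps_succ {n : ℕ} {c c' : TM2.Cfg Γ Λ σ} (h : Steps M (n + 1) c c') :
    ∃ l, c.l = some l ∧ Steps M n (TM2.stepAux (M l) c.var c.stk) c' := by
  obtain ⟨_ | l, s, T⟩ := c
  · have hnone : (flip bind (TM2.step M))^[n] none = none := iterate_fixed rfl n
    exact absurd (hnone.symm.trans h) (by simp)
  · exact ⟨l, rfl, h⟩

end Steps

section Compile

variable {V G : Type} (tm : FinTM2)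

/-- The stack alphabets of a compiled machine, which has the stacks of the program and those of the
subroutine `tm`. -/
abbrev Alphabet (V G : Type) (tm : FinTM2) : V ⊕ tm.K → Type
  | .inl _ => G
  | .inr k => tm.Γ k

/-- The internal states of a compiled machine: the last symbol that was read from a stack of the
program, and the state of the subroutine. -/
abbrev Register (G : Type) (tm : FinTM2) : Type := Option G × tm.σ

/-- The statements of a compiled machine. -/
abbrev Stmt (V G : Type) (tm : FinTM2) (Λ : Type) : Type :=
  TM2.Stmt (Alphabet V G tm) Λ (Register G tm)

/-- The stack contents of a compiled machine: `S` for the program and `T` for the subroutine. -/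
def joint (S : V → List G) (T : ∀ k, List (tm.Γ k)) : ∀ k, List (Alphabet V G tm k)
  | .inl v => S v
  | .inr k => T k

section StepAux

variable [DecidableEq V] (S : V → List G) (T : ∀ k, List (tm.Γ k)) {Λ : Type} (q : Stmt V G tm Λ)
  (s : Register G tm)

theorem update_joint_inl (v : V) (l : List G) :
    update (joint tm S T) (.inl v) l = joint tm (update S v l) T := by
  funext k
  rcases k with w | k
  · rcases eq_or_ne w v with rfl | h
    · simp [joint]
    · rw [update_of_ne (by simpa using h)]
      simp [joint, h]
  · rw [update_of_ne (by simp)]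
    rfl

theorem update_joint_inr (k : tm.K) (l : List (tm.Γ k)) :
    update (joint tm S T) (.inr k) l = joint tm S (update T k l) := by
  funext j
  rcases j with w | j
  · rw [update_of_ne (by simp)]
    rfl
  · rcases eq_or_ne j k with rfl | h
    · simp [joint]
    · rw [update_of_ne (by simpa using h)]
      simp [joint, h]

theorem stepAux_branch (f : Register G tm → Bool) (q' : Stmt V G tm Λ) :
    TM2.stepAux (.branch f q q') s (joint tm S T) =
      bif f s then TM2.stepAux q s (joint tm S T) else TM2.stepAux q' s (joint tm S T) := rfl

theorem stepAux_push_inl (v : V) (f : Register G tm → G) :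
    TM2.stepAux (.push (.inl v) f q) s (joint tm S T) =
      TM2.stepAux q s (joint tm (update S v (f s :: S v)) T) :=
  congrArg (TM2.stepAux q s) (update_joint_inl tm S T v (f s :: S v))

theorem stepAux_peek_inl (v : V) (f : Register G tm → Option G → Register G tm) :
    TM2.stepAux (.peek (.inl v) f q) s (joint tm S T) =
      TM2.stepAux q (f s (S v).head?) (joint tm S T) := rfl

theorem stepAux_pop_inl (v : V) (f : Register G tm → Option G → Register G tm) :
    TM2.stepAux (.pop (.inl v) f q) s (joint tm S T) =
      TM2.stepAux q (f s (S v).head?) (joint tm (update S v (S v).tail) T) :=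
  congrArg (TM2.stepAux q (f s (S v).head?)) (update_joint_inl tm S T v (S v).tail)

theorem stepAux_push_inr (k : tm.K) (f : Register G tm → tm.Γ k) :
    TM2.stepAux (.push (.inr k) f q) s (joint tm S T) =
      TM2.stepAux q s (joint tm S (update T k (f s :: T k))) :=
  congrArg (TM2.stepAux q s) (update_joint_inr tm S T k (f s :: T k))

theorem stepAux_peek_inr (k : tm.K) (f : Register G tm → Option (tm.Γ k) → Register G tm) :
    TM2.stepAux (.peek (.inr k) f q) s (joint tm S T) =
      TM2.stepAux q (f s (T k).head?) (joint tm S T) := rfl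

theorem stepAux_pop_inr (k : tm.K) (f : Register G tm → Option (tm.Γ k) → Register G tm) :
    TM2.stepAux (.pop (.inr k) f q) s (joint tm S T) =
      TM2.stepAux q (f s (T k).head?) (joint tm S (update T k (T k).tail)) :=
  congrArg (TM2.stepAux q (f s (T k).head?)) (update_joint_inr tm S T k (T k).tail)

end StepAux

/-- A statement of the subroutine as a statement of the compiled machine, which goes to the label
`r` instead of halting. -/
def embed {Λ : Type} (ι : tm.Λ → Λ) (r : Λ) : TM2.Stmt tm.Γ tm.Λ tm.σ → Stmt V G tm Λ
  | .push k f q => .push (.inr k) (fun s => f s.2) (embed ι r q)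
  | .peek k f q => .peek (.inr k) (fun s x => (s.1, f s.2 x)) (embed ι r q)
  | .pop k f q => .pop (.inr k) (fun s x => (s.1, f s.2 x)) (embed ι r q)
  | .load f q => .load (fun s => (s.1, f s.2)) (embed ι r q)
  | .branch f q q' => .branch (fun s => f s.2) (embed ι r q) (embed ι r q')
  | .goto f => .goto fun s => ι (f s.2)
  | .halt => .goto fun _ => r

/-- A configuration of the subroutine inside the compiled machine. -/
def embedCfg {Λ : Type} (ι : tm.Λ → Λ) (r : Λ) (x : Option G) (S : V → List G)
    (c : TM2.Cfg tm.Γ tm.Λ tm.σ) : TM2.Cfg (Alphabet V G tm) Λ (Register G tm) :=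
  ⟨some (c.l.elim r ι), (x, c.var), joint tm S c.stk⟩

section Embed

variable [DecidableEq V] {Λ : Type} (ι : tm.Λ → Λ) (r : Λ) (x : Option G) (S : V → List G)

theorem stepAux_embed (q : TM2.Stmt tm.Γ tm.Λ tm.σ) (s : tm.σ) (T : ∀ k, List (tm.Γ k)) :
    TM2.stepAux (embed (V := V) (G := G) tm ι r q) (x, s) (joint tm S T) =
      embedCfg tm ι r x S (TM2.stepAux q s T) := by
  induction q generalizing s T with
  | push k f q ih => exact (stepAux_push_inr tm S T _ _ k _).trans (ih _ _)
  | peek k f q ih => exact (stepAux_peek_inr tm S T _ _ k _).trans (ih _ _)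
  | pop k f q ih => exact (stepAux_pop_inr tm S T _ _ k _).trans (ih _ _)
  | load f _ ih => exact ih _ _
  | branch f q q' ih ih' =>
    simp only [embed, TM2.stepAux]
    cases f s <;> simp only [cond_true, cond_false, ih, ih']
  | goto f => rfl
  | halt => rfl

theorem steps_embed {M : Λ → Stmt V G tm Λ} (hM : ∀ l, M (ι l) = embed tm ι r (tm.m l)) {n : ℕ}
    {c c' : TM2.Cfg tm.Γ tm.Λ tm.σ} (h : Steps tm.m n c c') :
    Steps M n (embedCfg tm ι r x S c) (embedCfg tm ι r x S c') := by
  induction n generalizing c with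
  | zero =>
    cases h
    rfl
  | succ n ih =>
    obtain ⟨l, hl, h⟩ := exists_of_steps_succ h
    obtain ⟨_, s, T⟩ := c
    subst hl
    rw [add_comm]
    refine Steps.head ?_
    rw [Option.elim_some, hM, stepAux_embed]
    exact ih h

end Embed

/-- The labels of a compiled program. -/
inductive Label : Cmd V G → Type
  | skip : Label .skip
  | push (v a) : Label (.push v a)
  | pop (v) : Label (.pop v)
  | fst {c d} (l : Label c) : Label (.seq c d)
  | snd {c d} (l : Label d) : Label (.seq c d)
  | case (v f) : Label (.case v f)
  | alternative {v f} (o) (l : Label (f o)) : Label (.case v f)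
  | loop (v p c) : Label (.loop v p c)
  | body {v p c} (l : Label c) : Label (.loop v p c)
  | load (v) : Label (.call v)
  | run {v} (l : tm.Λ) : Label (.call v)
  | ret (v) : Label (.call v)

theorem finite_label [Finite G] (c : Cmd V G) : Finite (Label tm c) := by
  induction c with
  | skip => exact .of_surjective (fun _ : Unit => .skip) fun | .skip => ⟨(), rfl⟩
  | push v a => exact .of_surjective (fun _ : Unit => .push v a) fun | .push _ _ => ⟨(), rfl⟩
  | pop v => exact .of_surjective (fun _ : Unit => .pop v) fun | .pop _ => ⟨(), rfl⟩
  | seq c d ihc ihd =>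
    exact .of_surjective (Sum.elim .fst .snd) fun
      | .fst l => ⟨.inl l, rfl⟩
      | .snd l => ⟨.inr l, rfl⟩
  | case v f ih =>
    exact .of_surjective
      (fun x : Option (Σ o, Label tm (f o)) => x.elim (.case v f) fun y => .alternative y.1 y.2) fun
      | .case _ _ => ⟨none, rfl⟩
      | .alternative o l => ⟨some ⟨o, l⟩, rfl⟩
  | loop v p c ih =>
    exact .of_surjective (fun x : Option (Label tm c) => x.elim (.loop v p c) .body) fun
      | .loop _ _ _ => ⟨none, rfl⟩
      | .body l => ⟨some l, rfl⟩
  | call v =>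
    have := tm.ΛFin
    exact .of_surjective
      (fun x : Bool ⊕ tm.Λ => x.elim (fun b => cond b (.load v) (.ret v)) .run) fun
      | .load _ => ⟨.inl true, rfl⟩
      | .run l => ⟨.inr l, rfl⟩
      | .ret _ => ⟨.inl false, rfl⟩

/-- The first label of a compiled program. -/
def entry : ∀ c : Cmd V G, Label tm c
  | .skip => .skip
  | .push v a => .push v a
  | .pop v => .pop v
  | .seq c _ => .fst (entry c)
  | .case v f => .case v f
  | .loop v p c => .loop v p c
  | .call v => .load v

variable (inp : G → tm.Γ tm.k₀) (out : Option (tm.Γ tm.k₁) → G)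

/-- The code of a compiled program, which continues with the statement `k`. The maps `inp` and
`out` translate queries and answers between the alphabets of the program and the subroutine. -/
def code {Λ : Type} : ∀ {c : Cmd V G}, (Label tm c → Λ) → Stmt V G tm Λ → Label tm c → Stmt V G tm Λ
  | .skip, _, k, .skip => k
  | .push v a, _, k, .push _ _ => .push (.inl v) (fun _ => a) k
  | .pop v, _, k, .pop _ => .pop (.inl v) (fun s _ => s) k
  | .seq _ d, ι, _, .fst l => code (fun l => ι (.fst l)) (.goto fun _ => ι (.snd (entry tm d))) l
  | .seq _ _, ι, k, .snd l => code (fun l => ι (.snd l)) k l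
  | .case v f, ι, _, .case _ _ =>
    .peek (.inl v) (fun s o => (o, s.2)) (.goto fun s => ι (.alternative s.1 (entry tm (f s.1))))
  | .case _ _, ι, k, .alternative o l => code (fun l => ι (.alternative o l)) k l
  | .loop v p c, ι, k, .loop _ _ _ =>
    .peek (.inl v) (fun s o => (o, s.2))
      (.branch (fun s => p s.1) (.goto fun _ => ι (.body (entry tm c))) k)
  | .loop v p c, ι, _, .body l => code (fun l => ι (.body l)) (.goto fun _ => ι (.loop v p c)) l
  | .call v, ι, _, .load _ =>
    .pop (.inl v) (fun s o => (o, s.2))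
      (.branch (fun s => s.1.isSome)
        (.push (.inr tm.k₀) (fun s => inp (s.1.getD (out none))) (.goto fun _ => ι (.load v)))
        (.goto fun _ => ι (.run tm.main)))
  | .call v, ι, _, .run l => embed tm (fun l => ι (.run l)) (ι (.ret v)) (tm.m l)
  | .call v, _, k, .ret _ =>
    .pop (.inr tm.k₁) (fun s o => (some (out o), s.2))
      (.push (.inl v) (fun s => s.1.getD (out none)) k)

theorem initList_eq (l : List (tm.Γ tm.k₀)) :
    initList tm l = ⟨some tm.main, tm.initialState, update (fun _ => []) tm.k₀ l⟩ := by
  rw [initList]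
  congr 1
  funext k
  rcases eq_or_ne k tm.k₀ with rfl | h <;> simp [*]

theorem haltList_eq (l : List (tm.Γ tm.k₁)) :
    haltList tm l = ⟨none, tm.initialState, update (fun _ => []) tm.k₁ l⟩ := by
  rw [haltList]
  congr 1
  funext k
  rcases eq_or_ne k tm.k₁ with rfl | h <;> simp [*]

theorem joint_nil : joint tm (fun _ : V => ([] : List G)) (fun _ => []) = fun _ => [] := by
  funext k
  rcases k with _ | _ <;> rfl

theorem update_nil {K : Type} [DecidableEq K] {Γ : K → Type} (k : K) :
    update (fun _ => []) k [] = fun k => ([] : List (Γ k)) :=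
  update_eq_self_iff.2 rfl

/-- The configuration of the compiled machine between two commands. -/
def idle {Λ : Type} (l : Λ) (x : Option G) (S : V → List G) :
    TM2.Cfg (Alphabet V G tm) Λ (Register G tm) :=
  ⟨some l, (x, tm.initialState), joint tm S fun _ => []⟩

theorem steps_idle [DecidableEq V] {Λ : Type} (M : Λ → Stmt V G tm Λ) (l : Λ) (x : Option G)
    (S : V → List G) : Steps M 1 (idle tm l x S)
      (TM2.stepAux (M l) (x, tm.initialState) (joint tm S fun _ => [])) := rfl

variable (ans : Bool → tm.Γ tm.k₁)

/-- The subroutine that is computed by the machine `tm`, with `ans` coding its answers. -/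
def machineSubroutine : Subroutine G where
  symbol b := out (some (ans b))
  answers w b n := Steps tm.m n (initList tm (w.map inp)) (haltList tm [ans b])

variable [DecidableEq V] {Λ : Type} {M : Λ → Stmt V G tm Λ}

theorem steps_load {v : V} (ι : Label tm (.call v) → Λ) (k : Stmt V G tm Λ)
    (hM : ∀ l, M (ι l) = code tm inp out ι k l) {w : List G} (u : List (tm.Γ tm.k₀)) (x : Option G)
    {S : V → List G} (hS : S v = w) : ∃ x', Steps M (w.length + 1)
      ⟨some (ι (.load v)), (x, tm.initialState), joint tm S (update (fun _ => []) tm.k₀ u)⟩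
      ⟨some (ι (.run tm.main)), (x', tm.initialState),
        joint tm (update S v []) (update (fun _ => []) tm.k₀ (w.reverse.map inp ++ u))⟩ := by
  induction w generalizing u x S with
  | nil =>
    refine ⟨none, ?_⟩
    have h := Steps.one M (ι (.load v)) (x, tm.initialState)
      (joint tm S (update (fun _ => []) tm.k₀ u))
    rwa [hM, code, stepAux_pop_inl, hS] at h
  | cons a w ih =>
    obtain ⟨x', hx⟩ := ih (inp a :: u) (some a) (S := update S v w) (by simp)
    refine ⟨x', ?_⟩
    rw [List.length_cons, add_comm (w.length + 1)]
    refine Steps.head ?_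
    rw [hM, code, stepAux_pop_inl, hS]
    rw [List.head?_cons, stepAux_branch, Option.isSome_some, cond_true, stepAux_push_inr]
    simpa using hx

theorem steps_call {v : V} (ι : Label tm (.call v) → Λ) (k : Stmt V G tm Λ)
    (hM : ∀ l, M (ι l) = code tm inp out ι k l) {S : V → List G} {b : Bool} {n : ℕ}
    (h : (machineSubroutine tm inp out ans).answers (S v).reverse b n) (x : Option G) :
    Steps M ((S v).length + 1 + (n + 1)) (idle tm (ι (.load v)) x S)
      (TM2.stepAux k (some (out (some (ans b))), tm.initialState)
        (joint tm (update S v [out (some (ans b))]) fun _ => [])) := by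
  obtain ⟨x', hload⟩ := steps_load tm inp out ι k hM [] x (S := S) rfl
  rw [update_nil, List.append_nil] at hload
  have hrun := steps_embed tm (fun l => ι (.run l)) (ι (.ret v)) x' (update S v []) (M := M)
    (fun l => by rw [hM, code]) h
  rw [initList_eq, haltList_eq] at hrun
  have hret := Steps.one M (ι (.ret v)) (x', tm.initialState)
    (joint tm (update S v []) (update (fun _ => []) tm.k₁ [ans b]))
  rw [hM, code, stepAux_pop_inr, stepAux_push_inl] at hret
  refine hload.trans (hrun.trans ?_)
  simpa [update_nil, embedCfg] using hret

theorem steps_code {c : Cmd V G} {S S' : V → List G} {n : ℕ}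
    (h : Exec (machineSubroutine tm inp out ans) c S n S') {Λ : Type} {M : Λ → Stmt V G tm Λ}
    (ι : Label tm c → Λ) (k : Stmt V G tm Λ) (hM : ∀ l, M (ι l) = code tm inp out ι k l)
    (x : Option G) : ∃ x' : Option G, Steps M n (idle tm (ι (entry tm c)) x S)
      (TM2.stepAux k (x', tm.initialState) (joint tm S' fun _ => [])) := by
  induction h generalizing Λ M x with
  | skip S =>
    have h := steps_idle tm M (ι .skip) x S
    exact ⟨x, by rwa [hM, code] at h⟩
  | push v a S =>
    have h := steps_idle tm M (ι (.push v a)) x S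
    exact ⟨x, by rwa [hM, code, stepAux_push_inl] at h⟩
  | pop v S =>
    have h := steps_idle tm M (ι (.pop v)) x S
    exact ⟨x, by rwa [hM, code, stepAux_pop_inl] at h⟩
  | seq _ _ ihc ihd =>
    obtain ⟨x', hx'⟩ := ihc (fun l => ι (.fst l)) _ (fun l => hM (.fst l)) x
    obtain ⟨x'', hx''⟩ := ihd (fun l => ι (.snd l)) _ (fun l => hM (.snd l)) x'
    exact ⟨x'', hx'.trans hx''⟩
  | @case v f S S' n _ ih =>
    obtain ⟨x', hx'⟩ := ih (fun l => ι (.alternative _ l)) _ (fun l => hM (.alternative _ l))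
      (S v).head?
    refine ⟨x', Steps.head ?_⟩
    rw [entry, hM, code, stepAux_peek_inl]
    exact hx'
  | @loop_done v p c S hp =>
    refine ⟨(S v).head?, ?_⟩
    have h := steps_idle tm M (ι (.loop v p c)) x S
    rw [hM, code, stepAux_peek_inl, stepAux_branch, hp] at h
    exact h
  | @loop_step v p c S S' S'' m n hp _ _ ihc ihw =>
    obtain ⟨x', hx'⟩ := ihc (fun l => ι (.body l)) _ (fun l => hM (.body l)) (S v).head?
    obtain ⟨x'', hx''⟩ := ihw ι k hM x'
    refine ⟨x'', Steps.head ?_⟩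
    rw [entry, hM, code, stepAux_peek_inl, stepAux_branch, hp]
    exact hx'.trans hx''
  | call hO => exact ⟨_, steps_call tm inp out ans ι k hM hO x⟩

/-- The machine that runs the program `c` on an input on the stack `v₀` and then answers whether
the stack `v₁` is non-empty. -/
@[reducible] noncomputable def machine [Finite V] [Finite G] (c : Cmd V G) (v₀ v₁ : V) :
    FinTM2 :=
  have := finite_label tm c
  have := Fintype.ofFinite V
  have := tm.kFin
  have := tm.σFin
  { K := V ⊕ tm.K
    kFin := inferInstance
    kDecidableEq := inferInstance
    k₀ := .inl v₀
    k₁ := .inr tm.k₁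
    Γ := Alphabet V G tm
    Λ := Label tm c
    main := entry tm c
    ΛFin := Fintype.ofFinite _
    σ := Register G tm
    σFin := have := Fintype.ofFinite G; inferInstance
    initialState := (none, tm.initialState)
    Γk₀Fin := Fintype.ofFinite G
    m := code tm inp out id <|
      .pop (.inl v₁) (fun s o => (o, s.2)) <|
      .push (.inr tm.k₁) (fun s => ans s.1.isSome) <|
      .load (fun _ => (none, tm.initialState)) .halt }

section Machine

variable [Finite V] [Finite G] (c : Cmd V G) (v₀ v₁ : V)

theorem initList_machine (w : List G) : initList (machine tm inp out ans c v₀ v₁) w =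
    idle tm (entry tm c) none (update (fun _ => []) v₀ w) := by
  have h := update_joint_inl tm (fun _ => []) (fun _ => []) v₀ w
  rw [joint_nil] at h
  rw [initList_eq]
  exact congrArg (TM2.Cfg.mk _ _) h

theorem haltList_machine (b : tm.Γ tm.k₁) : haltList (machine tm inp out ans c v₀ v₁) [b] =
    ⟨none, (none, tm.initialState), joint tm (fun _ => []) (update (fun _ => []) tm.k₁ [b])⟩ := by
  have h := update_joint_inr tm (fun _ : V => ([] : List G)) (fun _ => []) tm.k₁ [b]
  rw [joint_nil] at h
  rw [haltList_eq]
  exact congrArg (TM2.Cfg.mk _ _) h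

variable {c v₀ v₁}

theorem steps_machine {w u : List G} {n : ℕ}
    (h : Exec (machineSubroutine tm inp out ans) c (update (fun _ => []) v₀ w) n
      (update (fun _ => []) v₁ u)) (hu : u.tail = []) :
    Steps (machine tm inp out ans c v₀ v₁).m n (initList (machine tm inp out ans c v₀ v₁) w)
      (haltList (machine tm inp out ans c v₀ v₁) [ans u.head?.isSome]) := by
  obtain ⟨x, hx⟩ := steps_code tm inp out ans h id _ (M := (machine tm inp out ans c v₀ v₁).m)
    (fun _ => rfl) none
  rw [stepAux_pop_inl, stepAux_push_inr] at hx
  simp only [update_self, update_idem, hu, update_nil] at hx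
  rw [initList_machine, haltList_machine]
  exact hx

end Machine

end Compile

/-- The program `c` leads from `S` to `S'` in at most `n` steps. -/
def Runs {V G : Type} [DecidableEq V] (O : Subroutine G) (c : Cmd V G) (S : V → List G) (n : ℕ)
    (S' : V → List G) : Prop :=
  ∃ m ≤ n, Exec O c S m S'

section PolyTimeMachine

variable {G J : Type} {encJ : J → List G} {g : J → Bool}
  (h : TM2ComputableInPolyTime encJ Computability.encodeBool g) (symbol : Bool → G)

/-- The subroutine given by a polynomial-time machine. -/
def subroutine : Subroutine G :=
  machineSubroutine h.tm h.inputAlphabet.invFun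
    (fun o => symbol ((o.map h.outputAlphabet).getD false)) h.outputAlphabet.invFun

theorem subroutine_symbol : (subroutine h symbol).symbol = symbol := by
  funext b
  simp [subroutine, machineSubroutine]

theorem exists_subroutine_answers (j : J) :
    ∃ n ≤ h.time.eval (encJ j).length, (subroutine h symbol).answers (encJ j) (g j) n :=
  ⟨_, (h.outputsFun j).steps_le_m, (h.outputsFun j).evals_in_steps⟩

theorem nonempty_computableInPolyTime {V I : Type} [DecidableEq V] [Finite V] [Finite G]
    {c : Cmd V G} {v₀ v₁ : V} (yes : G) {enc : I → List G} {f : I → Bool} {T : Polynomial ℕ}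
    (hc : ∀ i, Runs (subroutine h symbol) c (update (fun _ => []) v₀ (enc i))
      (T.eval (enc i).length) (update (fun _ => []) v₁ (bif f i then [yes] else []))) :
    Nonempty (TM2ComputableInPolyTime enc Computability.encodeBool f) := by
  choose n hn hE using hc
  have hf (i : I) : (bif f i then [yes] else []).head?.isSome = f i := by cases f i <;> rfl
  have hsteps (i : I) := steps_machine h.tm h.inputAlphabet.invFun
    (fun o => symbol ((o.map h.outputAlphabet).getD false)) h.outputAlphabet.invFun (hE i)
    (by cases f i <;> rfl)
  simp only [hf] at hsteps
  exact ⟨{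
    tm := machine h.tm h.inputAlphabet.invFun
      (fun o => symbol ((o.map h.outputAlphabet).getD false)) h.outputAlphabet.invFun c v₀ v₁
    inputAlphabet := Equiv.refl G
    outputAlphabet := h.outputAlphabet
    time := T
    outputsFun i := ⟨⟨n i, (congrArg (fun w => Steps _ (n i) (initList _ w) _)
      (List.map_id (enc i))).mpr (hsteps i)⟩, hn i⟩ }⟩

end PolyTimeMachine

section PolyBounded

theorem monotone_eval_nat (p : Polynomial ℕ) : Monotone fun n => p.eval n := by
  intro m n h
  simp only [Polynomial.eval_eq_sum, Polynomial.sum]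
  gcongr

/-- The function `t` is bounded by a polynomial in `size`. -/
def PolyBounded {I : Type} (size t : I → ℕ) : Prop :=
  ∃ p : Polynomial ℕ, ∀ i, t i ≤ p.eval (size i)

namespace PolyBounded

variable {I : Type} {size s t : I → ℕ}

theorem const (size : I → ℕ) (n : ℕ) : PolyBounded size fun _ => n :=
  ⟨.C n, fun _ => by rw [Polynomial.eval_C]⟩

theorem self (size : I → ℕ) : PolyBounded size size :=
  ⟨.X, fun _ => by rw [Polynomial.eval_X]⟩

theorem mono (ht : PolyBounded size t) (h : ∀ i, s i ≤ t i) : PolyBounded size s :=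
  ht.imp fun _ hp i => (h i).trans (hp i)

theorem add (hs : PolyBounded size s) (ht : PolyBounded size t) :
    PolyBounded size fun i => s i + t i := by
  obtain ⟨p, hp⟩ := hs
  obtain ⟨q, hq⟩ := ht
  exact ⟨p + q, fun i => by rw [Polynomial.eval_add]; exact add_le_add (hp i) (hq i)⟩

theorem mul (hs : PolyBounded size s) (ht : PolyBounded size t) :
    PolyBounded size fun i => s i * t i := by
  obtain ⟨p, hp⟩ := hs
  obtain ⟨q, hq⟩ := ht
  exact ⟨p * q, fun i => by rw [Polynomial.eval_mul]; exact Nat.mul_le_mul (hp i) (hq i)⟩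

theorem trans (hs : PolyBounded size s) (ht : PolyBounded s t) : PolyBounded size t := by
  obtain ⟨p, hp⟩ := hs
  obtain ⟨q, hq⟩ := ht
  exact ⟨q.comp p, fun i => by
    rw [Polynomial.eval_comp]
    exact (hq i).trans (monotone_eval_nat q (hp i))⟩

theorem eval (hs : PolyBounded size s) (p : Polynomial ℕ) :
    PolyBounded size fun i => p.eval (s i) :=
  hs.trans ⟨p, fun _ => le_rfl⟩

theorem comp {J : Type} (ht : PolyBounded size t) (φ : J → I) :
    PolyBounded (fun j => size (φ j)) fun j => t (φ j) :=
  ht.imp fun _ hp j => hp (φ j)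

end PolyBounded

end PolyBounded

section Exec

variable {V V' G : Type} [DecidableEq V] [DecidableEq V'] {O : Subroutine G}

theorem Exec.length_le {c : Cmd V G} {S S' : V → List G} {n : ℕ} (h : Exec O c S n S') (v : V) :
    (S' v).length ≤ (S v).length + n := by
  induction h with
  | skip => omega
  | push w a S => rcases eq_or_ne v w with rfl | hv <;> simp [*]
  | pop w S =>
    rcases eq_or_ne v w with rfl | hv
    · simp only [update_self, List.length_tail]
      omega
    · simp [hv]
  | seq => omega
  | case => omega
  | loop_done => omega
  | loop_step => omega
  | @call w S b n _ =>
    rcases eq_or_ne v w with rfl | hv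
    · simp only [update_self, List.length_singleton]
      omega
    · simp [hv]

/-- The program `c` with its stacks renamed by `ρ`. -/
def Cmd.map (ρ : V → V') : Cmd V G → Cmd V' G
  | .skip => .skip
  | .push v a => .push (ρ v) a
  | .pop v => .pop (ρ v)
  | .seq c d => .seq (c.map ρ) (d.map ρ)
  | .case v f => .case (ρ v) fun o => (f o).map ρ
  | .loop v p c => .loop (ρ v) p (c.map ρ)
  | .call v => .call (ρ v)

variable {ρ : V → V'}

theorem Exec.exists_map (hρ : Injective ρ) {c : Cmd V G} {S S' : V → List G} {n : ℕ}
    (h : Exec O c S n S') {T : V' → List G} (hT : T ∘ ρ = S) :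
    ∃ T', Exec O (c.map ρ) T n T' ∧ T' ∘ ρ = S' ∧ ∀ v ∉ Set.range ρ, T' v = T v := by
  have hupdate (T : V' → List G) (v : V) (l : List G) : update T (ρ v) l ∘ ρ = update (T ∘ ρ) v l ∧
      ∀ w ∉ Set.range ρ, update T (ρ v) l w = T w :=
    ⟨update_comp_eq_of_injective T hρ v l, fun w hw => update_of_ne (fun h => hw ⟨v, h.symm⟩) _ _⟩
  induction h generalizing T with subst hT
  | skip => exact ⟨T, .skip T, rfl, fun _ _ => rfl⟩
  | push v a => exact ⟨_, .push (ρ v) a T, hupdate T v _⟩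
  | pop v => exact ⟨_, .pop (ρ v) T, hupdate T v _⟩
  | seq _ _ ihc ihd =>
    obtain ⟨T', hc, hT', hoff'⟩ := ihc rfl
    obtain ⟨T'', hd, hT'', hoff''⟩ := ihd hT'
    exact ⟨T'', .seq hc hd, hT'', fun v hv => (hoff'' v hv).trans (hoff' v hv)⟩
  | case _ ih =>
    obtain ⟨T', hc, hT'⟩ := ih rfl
    exact ⟨T', .case hc, hT'⟩
  | loop_done hp => exact ⟨T, .loop_done hp, rfl, fun _ _ => rfl⟩
  | loop_step hp _ _ ihc ihw =>
    obtain ⟨T', hc, hT', hoff'⟩ := ihc rfl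
    obtain ⟨T'', hw, hT'', hoff''⟩ := ihw hT'
    exact ⟨T'', .loop_step hp hc hw, hT'', fun v hv => (hoff'' v hv).trans (hoff' v hv)⟩
  | @call v S b n hO => exact ⟨_, .call (v := ρ v) hO, hupdate T v _⟩

theorem Runs.mono {c : Cmd V G} {S S' : V → List G} {m n : ℕ} (h : Runs O c S m S') (hmn : m ≤ n) :
    Runs O c S n S' :=
  h.imp fun _ h => ⟨h.1.trans hmn, h.2⟩

theorem Runs.map (hρ : Injective ρ) {c : Cmd V G} {S S' : V → List G} {n : ℕ}
    (h : Runs O c S n S') {T T' : V' → List G} (hT : T ∘ ρ = S) (hT' : T' ∘ ρ = S')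
    (hoff : ∀ v ∉ Set.range ρ, T' v = T v) : Runs O (c.map ρ) T n T' := by
  obtain ⟨m, hm, h⟩ := h
  obtain ⟨T'', h, hT'', hoff''⟩ := h.exists_map hρ hT
  have hTT : T'' = T' := by
    funext v
    by_cases hv : v ∈ Set.range ρ
    · obtain ⟨w, rfl⟩ := hv
      exact congrFun (hT''.trans hT'.symm) w
    · rw [hoff'' v hv, hoff v hv]
  exact ⟨m, hm, hTT ▸ h⟩

end Exec

section Transforms

variable {R R' G I I' : Type} [Fintype R] [DecidableEq R] [Fintype R'] [DecidableEq R']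
  {O : Subroutine G}

/-- The total length of the contents of finitely many stacks. -/
def size (S : R → List G) : ℕ := ∑ r, (S r).length

/-- Some program on the stacks in `R`, with finitely many scratch stacks that are initially and
finally empty, leads from the contents `e i` to `e' i` for every `i : I`, in time polynomial in the
size of `e i`. -/
def Transforms (O : Subroutine G) (e e' : I → R → List G) : Prop :=
  ∃ (W : Type) (_ : Finite W) (_ : DecidableEq W) (c : Cmd (R ⊕ W) G) (t : I → ℕ),
    PolyBounded (fun i => size (e i)) t ∧
      ∀ i, Runs O c (Sum.elim (e i) fun _ => []) (t i) (Sum.elim (e' i) fun _ => [])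

/-- An extension of the contents of the stacks in `R` to one more stack. -/
def ext (a : List G) (S : R → List G) (r : Option R) : List G := r.elim a S

omit [Fintype R] in
@[simp]
theorem update_ext_none (a b : List G) (S : R → List G) : update (ext a S) none b = ext b S := by
  funext r
  rcases r with _ | r <;> simp [ext]

omit [Fintype R] in
@[simp]
theorem update_ext_some (a b : List G) (S : R → List G) (r : R) :
    update (ext a S) (some r) b = ext a (update S r b) := by
  funext r'
  rcases r' with _ | r'
  · simp [ext]
  · rcases eq_or_ne r' r with rfl | h <;> simp [ext, *]

omit [Fintype R] [DecidableEq R] in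
@[simp]
theorem ext_none (a : List G) (S : R → List G) : ext a S none = a := rfl

omit [Fintype R] [DecidableEq R] in
@[simp]
theorem ext_some (a : List G) (S : R → List G) (r : R) : ext a S (some r) = S r := rfl

omit [DecidableEq R] in
theorem length_le_size (S : R → List G) (r : R) : (S r).length ≤ size S :=
  Finset.single_le_sum (f := fun r => (S r).length) (fun _ _ => Nat.zero_le _) (Finset.mem_univ r)

omit [DecidableEq R] in
theorem size_ext (a : List G) (S : R → List G) : size (ext a S) = a.length + size S := by
  simp [size, ext]

namespace Transforms

variable {e e' : I → R → List G}

theorem polyBounded_size (h : Transforms O e e') :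
    PolyBounded (fun i => size (e i)) fun i => size (e' i) := by
  obtain ⟨W, _, _, c, t, ht, hc⟩ := h
  refine ((PolyBounded.self _).add ((PolyBounded.const _ (Fintype.card R)).mul ht)).mono fun i => ?_
  obtain ⟨n, hn, h⟩ := hc i
  calc size (e' i) ≤ ∑ r, ((e i r).length + t i) :=
        Finset.sum_le_sum fun r _ => (h.length_le (.inl r)).trans (Nat.add_le_add_left hn _)
    _ = size (e i) + Fintype.card R * t i := by simp [Finset.sum_add_distrib, size]

theorem frame {f f' : I' → R' → List G} (h : Transforms O e e') (φ : I' → I) {ρ : R → R'}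
    (hρ : Injective ρ) (hf : ∀ i r, f i (ρ r) = e (φ i) r) (hf' : ∀ i r, f' i (ρ r) = e' (φ i) r)
    (hoff : ∀ i, ∀ r ∉ Set.range ρ, f' i r = f i r) : Transforms O f f' := by
  obtain ⟨W, hW, hdec, c, t, ht, hc⟩ := h
  refine ⟨W, hW, hdec, c.map (Sum.map ρ id), fun i => t (φ i), ?_, fun i => ?_⟩
  · refine PolyBounded.trans ((PolyBounded.self _).mono fun i => ?_) (ht.comp φ)
    calc size (e (φ i)) = ∑ r, (f i (ρ r)).length := by simp only [size, hf]
      _ = ∑ r ∈ Finset.univ.map ⟨ρ, hρ⟩, (f i r).length := by rw [Finset.sum_map]; rfl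
      _ ≤ size (f i) := Finset.sum_le_sum_of_subset (Finset.subset_univ _)
  · refine (hc (φ i)).map (hρ.sumMap injective_id) (funext ?_) (funext ?_) ?_
    · rintro (r | w)
      exacts [hf i r, rfl]
    · rintro (r | w)
      exacts [hf' i r, rfl]
    · rintro (r | w) hr
      · exact hoff i r fun ⟨r', h⟩ => hr ⟨.inl r', congrArg Sum.inl h⟩
      · exact absurd ⟨.inr w, rfl⟩ hr

end Transforms

end Transforms

section Runs

variable {V G : Type} [DecidableEq V] {O : Subroutine G}

theorem Runs.seq {c d : Cmd V G} {S S' S'' : V → List G} {m n : ℕ} (hc : Runs O c S m S')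
    (hd : Runs O d S' n S'') : Runs O (.seq c d) S (m + n) S'' := by
  obtain ⟨m', hm, hc⟩ := hc
  obtain ⟨n', hn, hd⟩ := hd
  exact ⟨_, add_le_add hm hn, .seq hc hd⟩

theorem Runs.case {v : V} {f : Option G → Cmd V G} {S S' : V → List G} {n : ℕ}
    (h : Runs O (f (S v).head?) S n S') : Runs O (.case v f) S (1 + n) S' := by
  obtain ⟨m, hm, h⟩ := h
  exact ⟨_, Nat.add_le_add_left hm 1, .case h⟩

theorem Runs.loop {v : V} {p : Option G → Bool} {c : Cmd V G} {S : ℕ → V → List G} {n t : ℕ}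
    (hp : ∀ j < n, p (S j v).head? = true) (hn : p (S n v).head? = false)
    (hc : ∀ j < n, Runs O c (S j) t (S (j + 1))) :
    Runs O (.loop v p c) (S 0) (n * (1 + t) + 1) (S n) := by
  induction n generalizing S with
  | zero => exact ⟨1, by omega, .loop_done hn⟩
  | succ n ih =>
    obtain ⟨m, hm, h⟩ := hc 0 n.succ_pos
    obtain ⟨m', hm', h'⟩ := ih (S := fun j => S (j + 1)) (fun j hj => hp _ (by omega)) hn
      fun j hj => hc _ (by omega)
    exact ⟨_, by rw [Nat.succ_mul]; omega, .loop_step (hp 0 n.succ_pos) h h'⟩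

theorem Runs.enlarge {W W' : Type} [DecidableEq W] [DecidableEq W'] {ι : W → W'}
    (hι : Injective ι) {c : Cmd (V ⊕ W) G} {S S' : V → List G} {n : ℕ}
    (h : Runs O c (Sum.elim S fun _ => []) n (Sum.elim S' fun _ => [])) :
    Runs O (c.map (Sum.map id ι)) (Sum.elim S fun _ => []) n (Sum.elim S' fun _ => []) := by
  refine h.map (injective_id.sumMap hι) ?_ ?_ ?_
  · funext r
    rcases r with _ | _ <;> rfl
  · funext r
    rcases r with _ | _ <;> rfl
  · rintro (r | w) hr
    exacts [absurd ⟨.inl r, rfl⟩ hr, rfl]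

end Runs

namespace Transforms

variable {R G I : Type} [Fintype R] [DecidableEq R] {O : Subroutine G} {e e' e'' : I → R → List G}

theorem of_runs {c : Cmd R G} {t : I → ℕ} (ht : PolyBounded (fun i => size (e i)) t)
    (h : ∀ i, Runs O c (e i) (t i) (e' i)) : Transforms O e e' := by
  refine ⟨Empty, inferInstance, inferInstance, c.map .inl, t, ht, fun i => ?_⟩
  refine (h i).map Sum.inl_injective rfl rfl ?_
  rintro (r | w) hr
  exacts [absurd ⟨r, rfl⟩ hr, rfl]

theorem refl (e : I → R → List G) : Transforms O e e :=
  of_runs (.const _ 1) fun i => ⟨1, le_rfl, .skip (e i)⟩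

theorem push (e : I → R → List G) (v : R) (a : G) :
    Transforms O e fun i => update (e i) v (a :: e i v) :=
  of_runs (.const _ 1) fun i => ⟨1, le_rfl, .push v a (e i)⟩

theorem pop (e : I → R → List G) (v : R) : Transforms O e fun i => update (e i) v (e i v).tail :=
  of_runs (.const _ 1) fun i => ⟨1, le_rfl, .pop v (e i)⟩

theorem call (e : I → R → List G) (v : R) {b : I → Bool} {P : Polynomial ℕ}
    (hO : ∀ i, ∃ n ≤ P.eval (e i v).length, O.answers (e i v).reverse (b i) n) :
    Transforms O e fun i => update (e i) v [O.symbol (b i)] := by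
  have hlength : PolyBounded (fun i => size (e i)) fun i => (e i v).length :=
    (PolyBounded.self _).mono fun i => length_le_size (e i) v
  refine of_runs (c := .call v)
    ((hlength.add (.const _ 1)).add ((hlength.eval P).add (.const _ 1))) fun i => ?_
  obtain ⟨n, hn, h⟩ := hO i
  exact ⟨_, by omega, .call h⟩

theorem trans (h : Transforms O e e') (h' : Transforms O e' e'') : Transforms O e e'' := by
  have hsize := h.polyBounded_size
  obtain ⟨W, _, _, c, t, ht, hc⟩ := h
  obtain ⟨W', _, _, c', t', ht', hc'⟩ := h'
  exact ⟨W ⊕ W', inferInstance, inferInstance, _, _, ht.add (hsize.trans ht'), fun i =>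
    ((hc i).enlarge Sum.inl_injective).seq ((hc' i).enlarge Sum.inr_injective)⟩

theorem case [Finite G] (v : R)
    (h : ∀ o, Transforms O (fun i : {i // (e i v).head? = o} => e i) fun i => e' i) :
    Transforms O e e' := by
  choose W hfin hdec c t ht hc using h
  choose p hp using ht
  classical
  have := Fintype.ofFinite G
  refine ⟨Σ o, W o, inferInstance, inferInstance,
    .case (.inl v) fun o => (c o).map (Sum.map id (Sigma.mk o)), fun i => 1 + t _ ⟨i, rfl⟩,
    ⟨1 + ∑ o, p o, fun i => ?_⟩,
    fun i => Runs.case ((hc _ ⟨i, rfl⟩).enlarge sigma_mk_injective)⟩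
  rw [Polynomial.eval_add, Polynomial.eval_one, Polynomial.eval_finsetSum]
  exact Nat.add_le_add_left ((hp _ ⟨i, rfl⟩).trans (Finset.single_le_sum
    (f := fun o => (p o).eval (size (e i))) (fun _ _ => Nat.zero_le _) (Finset.mem_univ _))) 1

theorem loop (v : R) (p : Option G → Bool) {s : I → ℕ → R → List G} {n b : I → ℕ}
    (hp : ∀ i, ∀ j < n i, p (s i j v).head? = true) (hn : ∀ i, p (s i (n i) v).head? = false)
    (hpn : PolyBounded (fun i => size (s i 0)) n) (hpb : PolyBounded (fun i => size (s i 0)) b)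
    (hb : ∀ i, ∀ j < n i, size (s i j) ≤ b i)
    (h : Transforms O (fun x : {x : I × ℕ // x.2 < n x.1} => s x.1.1 x.1.2)
      fun x => s x.1.1 (x.1.2 + 1)) :
    Transforms O (fun i => s i 0) fun i => s i (n i) := by
  obtain ⟨W, hfin, hdec, c, t, ⟨q, hq⟩, hc⟩ := h
  exact ⟨W, hfin, hdec, .loop (.inl v) p c, fun i => n i * (1 + q.eval (b i)) + 1,
    (hpn.mul ((PolyBounded.const _ 1).add (hpb.eval q))).add (.const _ 1), fun i =>
    Runs.loop (S := fun j => Sum.elim (s i j) fun _ => []) (hp i) (hn i) fun j hj =>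
      (hc ⟨(i, j), hj⟩).mono ((hq _).trans (monotone_eval_nat q (hb i j hj)))⟩

theorem hide (h : Transforms O (fun i => ext [] (e i)) fun i => ext [] (e' i)) :
    Transforms O e e' := by
  obtain ⟨W, hfin, hdec, c, t, ht, hc⟩ := h
  let ρ : Option R ⊕ W → R ⊕ Option W := Sum.elim (fun r => r.elim (.inr none) .inl) (.inr ∘ some)
  refine ⟨Option W, inferInstance, inferInstance, c.map ρ, t, by simpa [size_ext] using ht,
    fun i => ?_⟩
  refine (hc i).map ?_ ?_ ?_ ?_
  · rintro ((_ | r) | w) ((_ | r') | w') h <;> simp_all [ρ]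
  · funext r
    rcases r with (_ | _) | _ <;> rfl
  · funext r
    rcases r with (_ | _) | _ <;> rfl
  · rintro (r | _ | w) hr
    exacts [absurd ⟨.inl (some r), rfl⟩ hr, rfl, rfl]

end Transforms

namespace Transforms

variable {R G I : Type} [Fintype R] [DecidableEq R] {O : Subroutine G} {e e' f : I → R → List G}

theorem congr (h : Transforms O e e') (he : ∀ i, e' i = f i) : Transforms O e f :=
  (funext he : e' = f) ▸ h

theorem push_each (e : I → R → List G) {ws : List R} (hws : ws.Nodup) (a : G) :
    Transforms O e fun i r => if r ∈ ws then a :: e i r else e i r := by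
  induction ws generalizing e with
  | nil => exact (refl e).congr fun i => by simp
  | cons w ws ih =>
    rw [List.nodup_cons] at hws
    refine ((push e w a).trans (ih _ hws.2)).congr fun i => funext fun r => ?_
    rcases eq_or_ne r w with rfl | hr <;> simp [*]

/-- The contents of the stacks while the symbols of `x` are moved, one by one, from the stack `v`
that holds `x ++ y` to each of the stacks in `ws`: `j` symbols have been moved. -/
def scanned (S : R → List G) (x y : List G) (v : R) (ws : List R) (j : ℕ) (r : R) : List G :=
  if r = v then x.drop j ++ y else if r ∈ ws then (x.take j).reverse ++ S r else S r

omit [Fintype R] in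
theorem scanned_zero {S : R → List G} {x y : List G} {v : R} {ws : List R} (hS : S v = x ++ y) :
    scanned S x y v ws 0 = S := by
  funext r
  rcases eq_or_ne r v with rfl | hr <;> simp [scanned, *]

theorem size_scanned_le {S : R → List G} {x y : List G} {v : R} {ws : List R} (hS : S v = x ++ y)
    (j : ℕ) : size (scanned S x y v ws j) ≤ (Fintype.card R + 1) * size S := by
  have hv := length_le_size S v
  rw [hS, List.length_append] at hv
  calc size (scanned S x y v ws j) ≤ ∑ r, ((S r).length + size S) := Finset.sum_le_sum fun r _ => by
        grind [scanned]
    _ = (Fintype.card R + 1) * size S := by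
        simp [Finset.sum_add_distrib, size, Nat.add_mul, Nat.add_comm]

variable [Finite G]

theorem scanned_succ {J : Type} {S : J → R → List G} {x y : J → List G} {v : R} {ws : List R}
    (hws : ws.Nodup) (hv : v ∉ ws) (k : J → ℕ) (hk : ∀ i, k i < (x i).length) :
    Transforms O (fun i => scanned (S i) (x i) (y i) v ws (k i))
      fun i => scanned (S i) (x i) (y i) v ws (k i + 1) := by
  have hget (i : J) :
      (scanned (S i) (x i) (y i) v ws (k i) v).head? = some ((x i)[k i]'(hk i)) := by
    rw [scanned, if_pos rfl, List.drop_eq_getElem_cons (hk i)]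
    rfl
  refine case v fun o => ?_
  rcases o with _ | a
  · exact (refl _).congr fun i => absurd (i.2.symm.trans (hget i)) (by simp)
  refine ((push_each _ hws a).trans (pop _ v)).congr fun ⟨i, hi⟩ => funext fun r => ?_
  obtain rfl : (x i)[k i]'(hk i) = a := Option.some.inj ((hget i).symm.trans hi)
  rcases eq_or_ne r v with rfl | hr
  · have hdrop := List.drop_eq_getElem_cons (hk i)
    simp only [scanned, if_true, hv, if_false, update_self, hdrop, List.cons_append,
      List.tail_cons]
  · have htake := List.take_succ_eq_append_getElem (hk i)
    have hreverse : ((x i).take (k i + 1)).reverse =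
        (x i)[k i]'(hk i) :: ((x i).take (k i)).reverse := by
      rw [htake, List.reverse_append, List.reverse_singleton, List.singleton_append]
    simp only [scanned, hr, if_false, update_of_ne hr, hreverse]
    split_ifs <;> rfl

theorem scan {p : G → Bool} {x y : I → List G} {v : R} {ws : List R} (he : ∀ i, e i v = x i ++ y i)
    (hx : ∀ i, ∀ a ∈ x i, p a = true) (hy : ∀ i, ∀ a ∈ (y i).head?, p a = false) (hws : ws.Nodup)
    (hv : v ∉ ws) : Transforms O e fun i r =>
      if r = v then y i else if r ∈ ws then (x i).reverse ++ e i r else e i r := by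
  have h0 (i : I) : scanned (e i) (x i) (y i) v ws 0 = e i := scanned_zero (he i)
  have hloop : Transforms O (fun i => scanned (e i) (x i) (y i) v ws 0)
      fun i => scanned (e i) (x i) (y i) v ws (x i).length := by
    refine loop v (·.elim false p) (fun i j hj => ?_) (fun i => ?_) ?_ ?_
      (fun i j _ => size_scanned_le (he i) j) (scanned_succ hws hv _ fun i => i.2)
    · rw [scanned, if_pos rfl, List.drop_eq_getElem_cons hj]
      exact hx i _ (List.getElem_mem hj)
    · rcases hyi : y i with _ | ⟨a, w⟩
      · simp [scanned]
      · simpa [scanned] using hy i a (by simp [hyi])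
    · refine (PolyBounded.self _).mono fun i => ?_
      have hle := length_le_size (e i) v
      rw [he, List.length_append] at hle
      rw [h0]
      omega
    · simp only [h0]
      exact (PolyBounded.const _ _).mul (.self _)
  simp only [h0] at hloop
  exact hloop.congr fun i => funext fun r => by simp [scanned]

theorem clear (e : I → R → List G) (v : R) : Transforms O e fun i => update (e i) v [] := by
  refine (scan (p := fun _ => true) (x := fun i => e i v) (y := fun _ => []) (v := v) (by simp)
    (by simp) (by simp) List.nodup_nil (by simp)).congr fun i => funext fun r => ?_
  rcases eq_or_ne r v with rfl | hr <;> simp [*]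

theorem pour (e : I → R → List G) {v w : R} (hvw : v ≠ w) :
    Transforms O e fun i => update (update (e i) v []) w ((e i v).reverse ++ e i w) := by
  refine (scan (p := fun _ => true) (x := fun i => e i v) (y := fun _ => []) (v := v) (by simp)
    (by simp) (by simp) (List.nodup_singleton w) (by simpa)).congr fun i => funext fun r => ?_
  rcases eq_or_ne r v with rfl | hr
  · simp [hvw]
  · rcases eq_or_ne r w with rfl | hr' <;> simp [*]

theorem move (e : I → R → List G) {v w : R} (hvw : v ≠ w) :
    Transforms O e fun i => update (update (e i) v []) w (e i v ++ e i w) := by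
  refine hide (((pour _ (v := some v) (w := none) (by simp)).trans
    (pour _ (v := none) (w := some w) (by simp))).congr fun i => funext fun r => ?_)
  rcases r with _ | r
  · simp [ext]
  rcases eq_or_ne r w with rfl | hr
  · simp [ext, hvw.symm]
  · rcases eq_or_ne r v with rfl | hr' <;> simp [ext, *]

end Transforms

/-- On the stacks in `K`, whose contents are preserved, the string `f i` is computed from the
contents `e i` in polynomial time. -/
def PolyTime {K G I : Type} [Fintype K] [DecidableEq K] (O : Subroutine G) (e : I → K → List G)
    (f : I → List G) : Prop :=
  Transforms O (fun i => ext [] (e i)) fun i => ext (f i) (e i)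

theorem Transforms.assign {K G I : Type} [Fintype K] [DecidableEq K] [Finite G] {O : Subroutine G}
    {e : I → K → List G} {f : I → List G} (v : K) (h : PolyTime O e f) :
    Transforms O e fun i => update (e i) v (f i) := by
  refine .hide (((Transforms.trans h (.clear _ (some v))).trans
    (.move _ (v := none) (w := some v) (by simp))).congr fun i => ?_)
  simp

namespace PolyTime

variable {K K' G I I' : Type} [Fintype K] [DecidableEq K] [Fintype K'] [DecidableEq K']
  {O : Subroutine G} {e : I → K → List G} {f g : I → List G}

theorem congr (h : PolyTime O e f) (hfg : ∀ i, f i = g i) : PolyTime O e g :=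
  (funext hfg : f = g) ▸ h

theorem polyBounded_length (h : PolyTime O e f) :
    PolyBounded (fun i => size (e i)) fun i => (f i).length := by
  have hsize := h.polyBounded_size
  simp only [size_ext, List.length_nil, zero_add] at hsize
  exact hsize.mono fun i => Nat.le_add_right _ _

theorem reindex (h : PolyTime O e f) (φ : I' → I) {ρ : K → K'} (hρ : Injective ρ)
    {e' : I' → K' → List G} (he : ∀ i k, e' i (ρ k) = e (φ i) k) :
    PolyTime O e' fun i => f (φ i) := by
  refine h.frame φ (Option.map_injective hρ) ?_ ?_ ?_
  · rintro i (_ | k)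
    exacts [rfl, he i k]
  · rintro i (_ | k)
    exacts [rfl, he i k]
  · rintro i (_ | k) hk
    exacts [absurd ⟨none, rfl⟩ hk, rfl]

theorem restrict (h : PolyTime O e f) (φ : I' → I) :
    PolyTime O (fun i => e (φ i)) fun i => f (φ i) :=
  h.reindex φ injective_id fun _ _ => rfl

theorem weaken (h : PolyTime O e f) (a : I → List G) : PolyTime O (fun i => ext (a i) (e i)) f :=
  h.reindex id (Option.some_injective K) fun _ _ => rfl

theorem lift_weaken {a : I → List G} (h : PolyTime O (fun i => ext (a i) (e i)) f)
    (b : I → List G) : PolyTime O (fun i => ext (a i) (ext (b i) (e i))) f :=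
  h.reindex id (Option.map_injective (Option.some_injective K)) (by rintro i (_ | k) <;> rfl)

theorem nil : PolyTime O e fun _ => [] := Transforms.refl _

theorem cons (a : G) (h : PolyTime O e f) : PolyTime O e fun i => a :: f i :=
  (Transforms.trans h (.push _ none a)).congr fun i => by simp

theorem tail (h : PolyTime O e f) : PolyTime O e fun i => (f i).tail :=
  (Transforms.trans h (.pop _ none)).congr fun i => by simp

variable (O e) in
theorem const (w : List G) : PolyTime O e fun _ => w := by
  induction w with
  | nil => exact nil
  | cons a w ih => exact ih.cons a

variable [Finite G]

variable (O e) in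
theorem var (k : K) : PolyTime O e fun i => e i k := by
  refine .hide (((Transforms.pour _ (v := some (some k)) (w := none) (by simp)).trans
    (Transforms.scan (p := fun _ => true) (x := fun i => (e i k).reverse) (y := fun _ => [])
      (v := none) (ws := [some (some k), some none]) (by simp) (by simp) (by simp) (by simp)
      (by simp))).congr fun i => funext fun r => ?_)
  rcases r with _ | _ | r
  · simp
  · simp
  · rcases eq_or_ne r k with rfl | hr <;> simp [*]

theorem letIn {a : I → List G} (ha : PolyTime O e a)
    (h : PolyTime O (fun i => ext (a i) (e i)) f) : PolyTime O e f := by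
  have hassign : Transforms O (fun i => ext (a i) (ext [] (e i)))
      fun i => ext (a i) (ext (f i) (e i)) :=
    (Transforms.assign (some none) (h.lift_weaken _)).congr fun i => by simp
  exact .hide (((ha.weaken _).trans hassign).trans
    ((Transforms.clear _ none).congr fun i => by simp))

theorem append (hf : PolyTime O e f) (hg : PolyTime O e g) : PolyTime O e fun i => f i ++ g i := by
  have hassign : Transforms O (fun i => ext (f i) (ext [] (e i)))
      fun i => ext (f i) (ext (g i) (e i)) :=
    (Transforms.assign (some none) ((hg.weaken _).weaken _)).congr fun i => by simp
  exact .hide (((hf.weaken _).trans hassign).trans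
    ((Transforms.move _ (v := none) (w := some none) (by simp)).congr fun i => by simp))

theorem before_sep {x y : I → List G} {s : G} (h : PolyTime O e fun i => x i ++ s :: y i)
    (hs : ∀ i, s ∉ x i) : PolyTime O e x := by
  classical
  have hscan : Transforms O (fun i => ext [] (ext (x i ++ s :: y i) (e i)))
      fun i => ext (x i).reverse (ext [] (e i)) :=
    ((Transforms.scan (p := (· ≠ s)) (x := x) (y := fun i => s :: y i) (v := some none)
      (ws := [none]) (fun i => rfl) (fun i a ha => by simpa using ne_of_mem_of_not_mem ha (hs i))
      (by simp) (by simp) (by simp)).trans (.clear _ (some none))).congr fun i => funext fun r => by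
        rcases r with _ | _ | r <;> simp
  have hassign : Transforms O (fun i => ext [] (ext [] (e i)))
      fun i => ext [] (ext (x i ++ s :: y i) (e i)) :=
    (Transforms.assign (some none) ((h.weaken _).weaken _)).congr fun i => by simp
  exact .hide ((hassign.trans hscan).trans
    ((Transforms.pour _ (v := none) (w := some none) (by simp)).congr fun i => by simp))

theorem after_sep {x y : I → List G} {s : G} (h : PolyTime O e fun i => x i ++ s :: y i)
    (hs : ∀ i, s ∉ x i) : PolyTime O e y := by
  classical
  exact ((Transforms.trans h (.scan (p := (· ≠ s)) (x := x) (y := fun i => s :: y i) (v := none)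
    (ws := []) (fun i => rfl) (fun i a ha => by simpa using ne_of_mem_of_not_mem ha (hs i))
    (by simp) (by simp) (by simp))).trans (.pop _ none)).congr fun i => funext fun r => by
      rcases r with _ | r <;> simp

theorem cases_head {a : I → List G} (ha : PolyTime O e a)
    (h : ∀ o, PolyTime O (fun i : {i // (a i).head? = o} => e i) fun i => f i) :
    PolyTime O e f := by
  have hcase : Transforms O (fun i => ext (a i) (ext [] (e i)))
      fun i => ext (a i) (ext (f i) (e i)) :=
    .case none fun o =>
      (Transforms.assign (some none) (((h o).weaken _).weaken _)).congr fun i => by simp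
  exact .hide (((ha.weaken _).trans hcase).trans ((Transforms.clear _ none).congr fun i => by simp))

theorem call {q : I → List G} {b : I → Bool} {T : Polynomial ℕ} (hq : PolyTime O e q)
    (hO : ∀ i, ∃ n ≤ T.eval (q i).length, O.answers (q i) (b i) n) :
    PolyTime O e fun i => [O.symbol (b i)] := by
  have hpour : Transforms O (fun i => ext (q i) (ext [] (e i)))
      fun i => ext [] (ext (q i).reverse (e i)) :=
    (Transforms.pour _ (v := none) (w := some none) (by simp)).congr fun i => by simp
  exact .hide (((hq.weaken _).trans hpour).trans ((Transforms.call _ (some none) (P := T)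
    (by simpa using hO)).congr fun i => by simp))

end PolyTime

theorem length_le_length_flatMap {β G : Type} {r : β → List G} (hr : ∀ b, r b ≠ []) (l : List β) :
    l.length ≤ (l.flatMap r).length := by
  rw [List.length_flatMap, ← List.length_map (as := l) fun b => (r b).length]
  exact List.length_le_sum_of_one_le _ (by simp [Nat.one_le_iff_ne_zero, hr])

/-- The codes `r b` are non-empty, and the code at the beginning of a computed string can be split
off in polynomial time, so that programs can process lists of items one item at a time. -/
structure SelfDelimiting {β G : Type} (O : Subroutine G) (r : β → List G) : Prop where
  ne_nil : ∀ b, r b ≠ []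
  first : ∀ {I K : Type} [Fintype K] [DecidableEq K] {e : I → K → List G} {b : I → β}
    {w : I → List G}, PolyTime O e (fun i => r (b i) ++ w i) → PolyTime O e fun i => r (b i)
  rest : ∀ {I K : Type} [Fintype K] [DecidableEq K] {e : I → K → List G} {b : I → β}
    {w : I → List G}, PolyTime O e (fun i => r (b i) ++ w i) → PolyTime O e w

section

variable {β γ G : Type} [Finite G] {O : Subroutine G}

theorem SelfDelimiting.append_sep {s : G} {x : β → List G} (hx : ∀ b, s ∉ x b) :
    SelfDelimiting O fun b => x b ++ [s] where
  ne_nil := by simp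
  first {I K _ _ e b w} h :=
    (h.congr fun i => List.append_assoc (x (b i)) [s] (w i)).before_sep (fun i => hx (b i))
      |>.append (.const O e [s])
  rest {I K _ _ e b w} h :=
    (h.congr fun i => List.append_assoc (x (b i)) [s] (w i)).after_sep fun i => hx (b i)

theorem SelfDelimiting.append {r : β → List G} {r' : γ → List G} (hr : SelfDelimiting O r)
    (hr' : SelfDelimiting O r') : SelfDelimiting O fun b : β × γ => r b.1 ++ r' b.2 where
  ne_nil b := by simp [hr.ne_nil]
  first {I K _ _ e b w} h := by
    have h := h.congr fun i => List.append_assoc (r (b i).1) (r' (b i).2) (w i)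
    exact (hr.first (b := fun i => (b i).1) h).append
      (hr'.first (b := fun i => (b i).2) (hr.rest (b := fun i => (b i).1) h))
  rest {I K _ _ e b w} h := hr'.rest (b := fun i => (b i).2)
    (hr.rest (b := fun i => (b i).1) (h.congr fun i => List.append_assoc _ _ _))

theorem SelfDelimiting.singleton : SelfDelimiting O fun a : G => [a] where
  ne_nil := by simp
  first {I K _ _ e b w} h :=
    h.cases_head fun o => (PolyTime.const O _ o.toList).congr fun i => by simp [← i.2]
  rest h := h.tail

namespace PolyTime

variable {K I : Type} [Fintype K] [DecidableEq K] {e : I → K → List G}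

theorem foldl_step {J : Type} {e : J → K → List G} {r : β → List G} {c : γ → List G} {b : J → β}
    {x y : J → γ} {w : J → List G} (hr : SelfDelimiting O r)
    (h : PolyTime O (fun j => ext (r (b j)) (ext (c (x j)) (e j))) fun j => c (y j)) :
    Transforms O (fun j => ext (r (b j) ++ w j) (ext (c (x j)) (e j)))
      fun j => ext (w j) (ext (c (y j)) (e j)) := by
  have hitem : PolyTime O (fun j => ext (r (b j) ++ w j) (ext (c (x j)) (e j)))
      fun j => r (b j) := hr.first (var O _ none)
  have hrest : PolyTime O (fun j => ext (r (b j) ++ w j) (ext (c (y j)) (e j))) w :=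
    hr.rest (b := b) (var O _ none)
  have hassign : Transforms O (fun j => ext (r (b j) ++ w j) (ext (c (x j)) (e j)))
      fun j => ext (r (b j) ++ w j) (ext (c (y j)) (e j)) :=
    (Transforms.assign (some none) (hitem.letIn (h.lift_weaken _))).congr fun j => by simp
  exact hassign.trans ((Transforms.assign none hrest).congr fun j => by simp)

theorem foldl {r : β → List G} {c : γ → List G} {L : I → List β} {s : I → γ} {step : I → γ → β → γ}
    {t : I → ℕ} (hr : SelfDelimiting O r) (hL : PolyTime O e fun i => (L i).flatMap r)
    (hs : PolyTime O e fun i => c (s i))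
    (hstep : PolyTime O (fun x : I × γ × β => ext (r x.2.2) (ext (c x.2.1) (e x.1)))
      fun x => c (step x.1 x.2.1 x.2.2))
    (ht : PolyBounded (fun i => size (e i)) t)
    (hle : ∀ i l, l <+: L i → (c (l.foldl (step i) (s i))).length ≤ t i) :
    PolyTime O e fun i => c ((L i).foldl (step i) (s i)) := by
  let S (i : I) (j : ℕ) : Option (Option K) → List G :=
    ext (((L i).drop j).flatMap r) (ext (c (((L i).take j).foldl (step i) (s i))) (e i))
  have hinit : Transforms O (fun i => ext [] (ext [] (e i))) fun i => S i 0 :=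
    (hL.weaken _).trans ((Transforms.assign (some none) ((hs.weaken _).weaken _)).congr
      fun i => by simp [S])
  have hloop : Transforms O (fun i => S i 0) fun i => S i (L i).length := by
    have hsize (i : I) (j : ℕ) : size (S i j) ≤ ((L i).flatMap r).length + (t i + size (e i)) := by
      simp only [S, size_ext]
      refine Nat.add_le_add ?_ (Nat.add_le_add_right (hle i _ ((L i).take_prefix j)) _)
      exact ((List.drop_sublist j (L i)).flatMap r).length_le
    have hbound : PolyBounded (fun i => size (S i 0)) fun i => size (e i) :=
      (PolyBounded.self _).mono fun i => by simp only [S, size_ext]; omega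
    have hcons (i : I) (j : ℕ) (hj : j < (L i).length) :
        ((L i).drop j).flatMap r = r (L i)[j] ++ ((L i).drop (j + 1)).flatMap r := by
      rw [List.drop_eq_getElem_cons hj, List.flatMap_cons]
    refine .loop none Option.isSome (fun i j hj => ?_) (by simp [S])
      (hbound.trans (hL.polyBounded_length.mono fun i => length_le_length_flatMap hr.ne_nil _))
      (hbound.trans (hL.polyBounded_length.add (ht.add (.self _)))) (fun i j _ => hsize i j) ?_
    · simp [S, hcons i j hj, hr.ne_nil]
    · convert foldl_step (w := fun x : {x : I × ℕ // x.2 < (L x.1).length} =>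
          ((L x.1.1).drop (x.1.2 + 1)).flatMap r) hr
        (hstep.restrict fun x : {x : I × ℕ // x.2 < (L x.1).length} =>
          (x.1.1, ((L x.1.1).take x.1.2).foldl (step x.1.1) (s x.1.1), (L x.1.1)[x.1.2]'x.2))
        using 2 with x x
      · simp only [S, hcons _ _ x.2]
      · simp only [S, List.take_succ_eq_append_getElem x.2, List.foldl_append, List.foldl_cons,
          List.foldl_nil]
  exact .hide ((hinit.trans hloop).congr fun i => by simp [S])

end PolyTime
end

section

variable {K I β γ G : Type} [Fintype K] [DecidableEq K] [Finite G] {O : Subroutine G}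
  {e : I → K → List G} {p p' : I → Prop}

namespace PolyTime

theorem flatMap {r : β → List G} {L : I → List β} {f : I → β → List G} (hr : SelfDelimiting O r)
    (hL : PolyTime O e fun i => (L i).flatMap r)
    (hf : PolyTime O (fun x : I × β => ext (r x.2) (e x.1)) fun x => f x.1 x.2) :
    PolyTime O e fun i => (L i).flatMap (f i) := by
  have hfoldl (i : I) (l : List β) : l.foldl (fun w b => w ++ f i b) [] = l.flatMap (f i) := by
    rw [List.foldl_append_eq_append, List.nil_append, List.flatMap_def]
  obtain ⟨T, hT⟩ := hf.polyBounded_length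
  have hstep : PolyTime O (fun x : I × List G × β => ext (r x.2.2) (ext x.2.1 (e x.1)))
      fun x => x.2.1 ++ f x.1 x.2.2 :=
    (var O _ (some none)).append
      ((hf.restrict fun x : I × List G × β => (x.1, x.2.2)).lift_weaken _)
  refine (foldl (c := id) (s := fun _ => []) (step := fun i w b => w ++ f i b) hr hL nil hstep
    (hL.polyBounded_length.mul ((hL.polyBounded_length.add (.self _)).eval T))
    fun i l hl => ?_).congr fun i => hfoldl i _
  have hmem (b : β) (hb : b ∈ l) :
      (f i b).length ≤ T.eval (((L i).flatMap r).length + size (e i)) := by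
    refine (hT (i, b)).trans (monotone_eval_nat T ?_)
    simp only [size_ext]
    exact Nat.add_le_add_right
      (List.sublist_flatten_of_mem (List.mem_map_of_mem (hl.subset hb))).length_le _
  rw [hfoldl, id, List.length_flatMap]
  refine (List.sum_le_card_nsmul _ _ (List.forall_mem_map.2 hmem)).trans ?_
  rw [List.length_map, smul_eq_mul]
  exact Nat.mul_le_mul_right _ (hl.length_le.trans (length_le_length_flatMap hr.ne_nil _))

theorem iterate {c : γ → List G} {w : I → List G} {s : I → γ} {F : I → γ → γ} {t : I → ℕ}
    (hw : PolyTime O e w) (hs : PolyTime O e fun i => c (s i))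
    (hF : PolyTime O (fun x : I × γ => ext (c x.2) (e x.1)) fun x => c (F x.1 x.2))
    (ht : PolyBounded (fun i => size (e i)) t)
    (hle : ∀ i, ∀ n ≤ (w i).length, (c ((F i)^[n] (s i))).length ≤ t i) :
    PolyTime O e fun i => c ((F i)^[(w i).length] (s i)) := by
  refine (foldl (step := fun i x _ => F i x) .singleton
    (hw.congr fun i => (w i).flatMap_singleton'.symm) hs
    ((hF.restrict fun x : I × γ × G => (x.1, x.2.1)).weaken _) ht
    fun i l hl => ?_).congr fun i => ?_
  · rw [List.foldl_const]
    exact hle i _ hl.length_le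
  · rw [List.foldl_const]

end PolyTime

/-- The property `p i` is decided in polynomial time from the contents `e i` of the stacks in `K`:
some computable string is non-empty if and only if `p i` holds. -/
def PolyDec (O : Subroutine G) (e : I → K → List G) (p : I → Prop) : Prop :=
  ∃ f, PolyTime O e f ∧ ∀ i, f i ≠ [] ↔ p i

theorem PolyTime.ite [∀ i, Decidable (p i)] {f g : I → List G} (hp : PolyDec O e p)
    (hf : PolyTime O e f) (hg : PolyTime O e g) :
    PolyTime O e fun i => if p i then f i else g i := by
  obtain ⟨a, ha, hap⟩ := hp
  refine ha.cases_head fun o => ?_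
  rcases o with _ | s
  · refine (hg.restrict _).congr fun ⟨i, hi⟩ => (if_neg ?_).symm
    rw [← hap, not_not]
    exact List.head?_eq_none_iff.1 hi
  · refine (hf.restrict _).congr fun ⟨i, hi⟩ => (if_pos ((hap i).1 fun h => ?_)).symm
    simp [h] at hi

namespace PolyDec

omit [Finite G] in
theorem congr (h : PolyDec O e p) (hpp' : ∀ i, p i ↔ p' i) : PolyDec O e p' :=
  h.imp fun _ h => ⟨h.1, fun i => (h.2 i).trans (hpp' i)⟩

theorem not (h : PolyDec O e p) : PolyDec O e fun i => ¬p i := by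
  classical
  exact ⟨_, .ite h .nil (.const O e [O.symbol true]), fun i => by by_cases hi : p i <;> simp [hi]⟩

theorem and (h : PolyDec O e p) (h' : PolyDec O e p') : PolyDec O e fun i => p i ∧ p' i := by
  classical
  obtain ⟨f, hf, hfp⟩ := h'
  exact ⟨_, .ite h hf .nil, fun i => by by_cases hi : p i <;> simp [hi, ← hfp]⟩

theorem exists_mem {r : β → List G} {L : I → List β} {p : I → β → Prop} (hr : SelfDelimiting O r)
    (hL : PolyTime O e fun i => (L i).flatMap r)
    (h : PolyDec O (fun x : I × β => ext (r x.2) (e x.1)) fun x => p x.1 x.2) :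
    PolyDec O e fun i => ∃ b ∈ L i, p i b := by
  obtain ⟨f, hf, hfp⟩ := h
  exact ⟨_, .flatMap (f := fun i b => f (i, b)) hr hL hf, fun i => by
    simp [← fun b => hfp (i, b)]⟩

theorem forall_mem {r : β → List G} {L : I → List β} {p : I → β → Prop} (hr : SelfDelimiting O r)
    (hL : PolyTime O e fun i => (L i).flatMap r)
    (h : PolyDec O (fun x : I × β => ext (r x.2) (e x.1)) fun x => p x.1 x.2) :
    PolyDec O e fun i => ∀ b ∈ L i, p i b :=
  (exists_mem (p := fun i b => ¬p i b) hr hL h.not).not.congr fun i => by simp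

open Classical in
/-- One step of the comparison of two strings that do not contain `s`: strip the symbol `a`, and
leave the string `[s]` if this is not possible. -/
noncomputable def strip (s : G) (w : List G) (a : G) : List G :=
  if w.head? = some a then w.tail else [s]

omit [Finite G] in
theorem foldl_strip_eq_nil {s : G} {x y : List G} (hs : s ∉ x) :
    x.foldl (strip s) y = [] ↔ x = y := by
  induction x generalizing y with
  | nil => exact eq_comm
  | cons a x ih =>
    simp only [List.mem_cons, not_or] at hs
    rw [List.foldl_cons, ih hs.2, strip]
    rcases y with _ | ⟨b, y⟩ <;> grind

omit [Finite G] in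
theorem length_foldl_strip_le (s : G) (x y : List G) :
    (x.foldl (strip s) y).length ≤ max y.length 1 := by
  induction x generalizing y with
  | nil => exact le_max_left _ _
  | cons a x ih =>
    refine (ih _).trans (max_le ?_ (le_max_right _ _))
    rw [strip]
    split_ifs
    · exact y.tail_sublist.length_le.trans (le_max_left _ _)
    · exact le_max_right _ _

theorem polyTime_strip {J : Type} {e : J → K → List G} (s : G) {w : J → List G} {a : J → G}
    (hw : PolyTime O e w) (ha : PolyTime O e fun j => [a j]) :
    PolyTime O e fun j => strip s (w j) (a j) := by
  classical
  refine hw.cases_head fun o => (ha.restrict _).cases_head fun o' => ?_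
  by_cases h : o = o'
  · refine ((hw.restrict _).restrict _).tail.congr fun ⟨⟨j, hj⟩, hj'⟩ => (if_pos ?_).symm
    exact hj.trans (h.trans hj'.symm)
  · refine (PolyTime.const O _ [s]).congr fun ⟨⟨j, hj⟩, hj'⟩ => (if_neg ?_).symm
    exact fun h' => h (hj.symm.trans (h'.trans hj'))

theorem eq {x y : I → List G} (s : G) (hx : PolyTime O e x) (hy : PolyTime O e y)
    (hs : ∀ i, s ∉ x i) : PolyDec O e fun i => x i = y i := by
  have hfold : PolyTime O e fun i => (x i).foldl (strip s) (y i) :=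
    .foldl (c := id) (step := fun _ => strip s) .singleton
      (hx.congr fun i => (x i).flatMap_singleton'.symm) hy
      (polyTime_strip s (.var O _ (some none)) (.var O _ none))
      (hy.polyBounded_length.add (.const _ 1)) fun i l _ =>
        (length_foldl_strip_le s l (y i)).trans (by omega)
  exact (show PolyDec O e _ from ⟨_, hfold, fun i => Iff.rfl⟩).not.congr fun i => by
    rw [not_not, foldl_strip_eq_nil (hs i)]

theorem call {q : I → List G} {b : I → Bool} {T : Polynomial ℕ} (hq : PolyTime O e q)
    (hO : ∀ i, ∃ n ≤ T.eval (q i).length, O.answers (q i) (b i) n)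
    (hsymbol : Injective O.symbol) : PolyDec O e fun i => b i = true := by
  classical
  refine ⟨fun i => if b i then [O.symbol true] else [], (hq.call hO).cases_head fun o => ?_,
    fun i => by simp⟩
  by_cases h : o = some (O.symbol true)
  · refine (PolyTime.const O _ [O.symbol true]).congr fun ⟨i, hi⟩ => (if_pos ?_).symm
    exact hsymbol (Option.some.inj (hi.trans h))
  · refine PolyTime.nil.congr fun ⟨i, hi⟩ => (if_neg fun hb => h ?_).symm
    rw [← hi, hb]
    rfl

end PolyDec
end

section

variable {K I β γ G : Type} [Fintype K] [DecidableEq K] [Finite G] {O : Subroutine G}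
  {e : I → K → List G}

theorem PolyDec.comp {enc : γ → List G} {p : γ → Prop} (h : PolyDec O (fun c (_ : Unit) => enc c) p)
    {c : I → γ} (hc : PolyTime O e fun i => enc (c i)) : PolyDec O e fun i => p (c i) := by
  obtain ⟨f, hf, hfp⟩ := h
  exact ⟨_, hc.letIn (hf.reindex c (ρ := fun _ => none) (fun _ _ _ => rfl) fun _ _ => rfl),
    fun i => hfp _⟩

theorem PolyTime.flatMap_filter {r : β → List G} {L : I → List β} {p : I → β → Prop}
    [∀ i b, Decidable (p i b)] {f : I → β → List G} (hr : SelfDelimiting O r)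
    (hL : PolyTime O e fun i => (L i).flatMap r)
    (hp : PolyDec O (fun x : I × β => ext (r x.2) (e x.1)) fun x => p x.1 x.2)
    (hf : PolyTime O (fun x : I × β => ext (r x.2) (e x.1)) fun x => f x.1 x.2) :
    PolyTime O e fun i => ((L i).filter fun b => p i b).flatMap (f i) := by
  classical
  have hite : PolyTime O e fun i => (L i).flatMap fun b => if p i b then f i b else [] :=
    .flatMap (f := fun i b => if p i b then f i b else []) hr hL (.ite hp hf .nil)
  refine hite.congr fun i => ?_
  induction L i with
  | nil => rfl
  | cons b l ih => by_cases h : p i b <;> simp [h, ih]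

end

open Computability in
theorem PolyDec.nonempty_computableInPolyTime {I J G : Type} [Finite G] {encJ : J → List G}
    {g : J → Bool} {h : TM2ComputableInPolyTime encJ encodeBool g} {symbol : Bool → G}
    {enc : I → List G} {p : I → Prop} [∀ i, Decidable (p i)]
    (hp : PolyDec (subroutine h symbol) (fun i (_ : Unit) => enc i) p) :
    Nonempty (TM2ComputableInPolyTime enc encodeBool fun i => decide (p i)) := by
  have hdecide : Transforms (subroutine h symbol) (fun i => ext [] fun _ : Unit => enc i)
      fun i => ext (if p i then [symbol true] else []) fun _ => [] :=
    (Transforms.trans (PolyTime.ite hp (.const _ _ [symbol true]) .nil)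
      (.clear _ (some ()))).congr fun i => funext fun r => by rcases r with _ | _ <;> simp
  obtain ⟨W, _, _, c, t, ⟨T, hT⟩, hc⟩ := hdecide
  have hle (i : I) : t i ≤ T.eval (enc i).length := by simpa [size] using hT i
  refine StackProg.nonempty_computableInPolyTime h symbol (c := c) (v₀ := .inl (some ()))
    (v₁ := .inl none) (T := T) (symbol true) fun i => ?_
  convert (hc i).mono (hle i) using 1 <;> funext v <;>
    rcases v with (_ | _) | _ <;> simp

end StackProg

namespace DataTree

open StackProg

section Filters

variable {α : Type} {P : Set (Pattern α)}

/-- Every pair `(d, {q})` satisfies one of the filters in `fs`. -/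
def Covers (fs : List (Filt P)) (q : ℕ) : Prop := ∀ d : List α, ∃ f ∈ fs, f.Sat d {q}

/-- The filter `¬ f₁ ∧ … ∧ ¬ fₙ ∧ q`. -/
def avoid (fs : List (Filt P)) (q : ℕ) : Filt P :=
  fs.foldr (fun f g => .and (.not f) g) (.state q)

theorem sat_avoid {fs : List (Filt P)} {q : ℕ} {d : List α} {Q : Set ℕ} :
    (avoid fs q).Sat d Q ↔ (∀ f ∈ fs, ¬f.Sat d Q) ∧ q ∈ Q := by
  induction fs with
  | nil => simp [avoid, Filt.Sat]
  | cons f fs ih =>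
    change ¬f.Sat d Q ∧ (avoid fs q).Sat d Q ↔ _
    rw [ih, List.forall_mem_cons, and_assoc]

theorem singletonValid_not_avoid {fs : List (Filt P)} {q : ℕ} :
    (Filt.not (avoid fs q)).SingletonValid ↔ Covers fs q := by
  have hsat (d : List α) (Q : Set ℕ) :
      (Filt.not (avoid fs q)).Sat d Q ↔ (q ∈ Q → ∃ f ∈ fs, f.Sat d Q) := by
    rw [Filt.Sat, sat_avoid]
    push Not
    grind
  simp only [Filt.SingletonValid, hsat]
  exact ⟨fun h d => h d {q} Set.subsingleton_singleton rfl,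
    fun h d Q hQ hq => hQ.eq_singleton_of_mem hq ▸ h d⟩

theorem exists_sat_iff_not_covers {f : Filt P} {q : ℕ} :
    (∃ d, f.Sat d {q}) ↔ ¬Covers [.not f] q := by
  simp [Covers, Filt.Sat]

theorem encode_avoid (fs : List (Filt P)) (q : ℕ) : (avoid fs q).encode =
    (fs.flatMap fun f => Sym.and :: Sym.not :: f.encode) ++ Sym.state :: encodeName q := by
  induction fs with
  | nil => rfl
  | cons f fs ih =>
    change Sym.and :: (Sym.not :: f.encode ++ (avoid fs q).encode) = _
    rw [ih]
    simp

end Filters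

section Encodings

variable {α : Type} {P : Set (Pattern α)}

theorem encodeName_injective : Function.Injective (encodeName : ℕ → List (Sym α)) := by
  intro m n h
  have hnum := List.map_injective_iff.2 (fun x y hxy => by simpa using hxy) h
  rw [← Computability.decode_encodeNat m, hnum, Computability.decode_encodeNat]

theorem sep_notMem_encodeName (n : ℕ) : (Sym.sep : Sym α) ∉ encodeName n := by
  simp [encodeName]

theorem sep_notMem_encode_pattern (x : Pattern α) : Sym.sep ∉ x.encode := by
  induction x <;> simp [Pattern.encode, *]

theorem sep_notMem_encode_filt (f : Filt P) : Sym.sep ∉ f.encode := by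
  induction f <;> simp [Filt.encode, sep_notMem_encodeName, sep_notMem_encode_pattern, *]

theorem close_notMem_encodeItem (n : ℕ) : (Sym.close : Sym α) ∉ encodeItem n := by
  simp [encodeItem, encodeName]

theorem close_notMem_encode_pattern (x : Pattern α) : Sym.close ∉ x.encode := by
  induction x <;> simp [Pattern.encode, *]

theorem close_notMem_encode_filt (f : Filt P) : Sym.close ∉ f.encode := by
  induction f <;> simp [Filt.encode, encodeName, close_notMem_encode_pattern, *]

end Encodings

theorem iterate_nil_subset {β : Type} {F : List β → List β}
    (hF : ∀ l l', l ⊆ l' → F l ⊆ F l') {B : List β} (hB : ∀ l, F l ⊆ B) {n : ℕ}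
    (hn : B.length ≤ n) : F (F^[n] []) ⊆ F^[n] [] := by
  classical
  have htoFinset {l l' : List β} : l.toFinset ⊆ l'.toFinset ↔ l ⊆ l' :=
    Multiset.toFinset_subset.trans Multiset.coe_subset
  have hsucc (m : ℕ) : F^[m + 1] [] = F (F^[m] []) := Function.iterate_succ_apply' F m []
  have hchain (m : ℕ) : F^[m] [] ⊆ F^[m + 1] [] := by
    induction m with
    | zero => exact List.nil_subset _
    | succ m ih => simpa only [hsucc] using hF _ _ ih
  have hcard (m : ℕ) : (F^[m] []).toFinset.card = (F^[m + 1] []).toFinset.card ↔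
      F^[m + 1] [] ⊆ F^[m] [] := by
    have hsub : (F^[m] []).toFinset ⊆ (F^[m + 1] []).toFinset :=
      htoFinset.2 (hchain m)
    rw [← htoFinset]
    exact ⟨fun h => (Finset.eq_of_subset_of_card_le hsub h.ge).ge,
      fun h => congrArg _ (hsub.antisymm h)⟩
  have hbound (m : ℕ) : (F^[m] []).toFinset.card ≤ B.length := by
    cases m with
    | zero => exact Nat.zero_le _
    | succ m =>
      rw [hsucc]
      exact (Finset.card_le_card (htoFinset.2 (hB _))).trans B.toFinset_card_le
  have hstab {m : ℕ} (hm : B.length ≤ m) :=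
    Nat.stabilises_of_monotone (f := fun m => (F^[m] []).toFinset.card)
      (monotone_nat_of_le_succ fun m => Finset.card_le_card (htoFinset.2 (hchain m))) hbound
      (fun m h => (hcard _).2 (by simpa only [hsucc] using hF _ _ ((hcard m).1 h))) hm
  rw [← hsucc, ← hcard]
  exact (hstab hn).trans (hstab (hn.trans n.le_succ)).symm

namespace AUTC

variable {α : Type} {P : Set (Pattern α)} (A : AUTC P)

/-- The rules `(p₀, p) → q`, as pairs of names. -/
def rulePairs : List (ℕ × ℕ) := A.aut.rules.map fun r => (r.1.1.2.1, r.2)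

/-- The horizontal transitions, with the names of their states. -/
def transTriples : List (ℕ × Filt P × ℕ) := A.H.rules.map fun r => (r.1.1, r.2.1, r.2.2.1)

/-- The names of the initial horizontal state and of the targets of the transitions: the only
horizontal states that can be accessible. -/
def candidates : List ℕ := A.p₀.1 :: A.transTriples.map fun t => t.2.2

/-- The filters of the transitions that leave the horizontal state `p`. -/
def outFilters (p : ℕ) : List (Filt P) :=
  (A.transTriples.filter fun t => t.1 = p).map fun t => t.2.1

/-- The vertical states `q` of the rules `(p₀, p) → q` with `p` in `G`. -/
def fired (G : List ℕ) : List ℕ := (A.rulePairs.filter fun r => r.1 ∈ G).map Prod.snd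

open Classical in
/-- One round of the saturation: the initial horizontal state, and the states that are reached from
states in `G` by reading `(d, {q})` for some vertical state `q` obtained from `G`. -/
noncomputable def advance (G : List ℕ) : List ℕ :=
  A.p₀.1 :: (A.transTriples.filter fun t =>
    t.1 ∈ G ∧ ∃ q ∈ A.fired G, ∃ d, t.2.1.Sat d {q}).map fun t => t.2.2

/-- The names of the horizontal states obtained by iterated saturation. Each round that changes
something adds one of the candidates, so the length of the input bounds the number of rounds. -/
noncomputable def saturation : List ℕ := A.advance^[(A.encode).length] []

variable {A} {G : List ℕ}

theorem mem_transTriples {p p' : A.H.State} {f : Filt P} :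
    (p.1, f, p'.1) ∈ A.transTriples ↔ (p, f, p') ∈ A.H.rules := by
  simp only [transTriples, List.mem_map, Prod.mk.injEq]
  constructor
  · rintro ⟨⟨r, g, r'⟩, hr, hp, rfl, hp'⟩
    rwa [← Subtype.ext hp, ← Subtype.ext hp']
  · exact fun h => ⟨_, h, rfl, rfl, rfl⟩

theorem mem_fired {q : ℕ} : q ∈ A.fired G ↔ q ∈ A.targets {p | p.1 ∈ G} := by
  simp only [fired, rulePairs, targets, List.mem_map, List.mem_filter, decide_eq_true_iff]
  constructor
  · rintro ⟨_, ⟨⟨r, hr, rfl⟩, hG⟩, rfl⟩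
    exact ⟨r, hr, hG, rfl⟩
  · rintro ⟨r, hr, hG, rfl⟩
    exact ⟨_, ⟨⟨r, hr, rfl⟩, hG⟩, rfl⟩

theorem mem_advance {x : ℕ} : x ∈ A.advance G ↔ x = A.p₀.1 ∨
    ∃ p : A.H.State, p.1 ∈ G ∧ ∃ q ∈ A.fired G, ∃ d, ∃ p', A.H.Reads p d {q} p' ∧ p'.1 = x := by
  simp only [advance, List.mem_cons, List.mem_map, List.mem_filter, decide_eq_true_iff,
    HorAut.Reads, transTriples]
  refine or_congr_right ⟨?_, ?_⟩
  · rintro ⟨_, ⟨⟨⟨p, f, p'⟩, hr, rfl⟩, hp, q, hq, d, hd⟩, rfl⟩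
    exact ⟨p, hp, q, hq, d, p', ⟨f, hr, hd⟩, rfl⟩
  · rintro ⟨p, hp, q, hq, d, p', ⟨f, hr, hd⟩, rfl⟩
    exact ⟨_, ⟨⟨_, hr, rfl⟩, hp, q, hq, d, hd⟩, rfl⟩

theorem covers_outFilters {p : A.H.State} {q : ℕ} :
    Covers (A.outFilters p.1) q ↔ ∀ d, ∃ p', A.H.Reads p d {q} p' := by
  refine forall_congr' fun d => ?_
  simp only [outFilters, List.mem_map, List.mem_filter, decide_eq_true_iff, HorAut.Reads,
    ← mem_transTriples]
  constructor
  · rintro ⟨f, ⟨⟨x, _, y⟩, ⟨ht, rfl : x = p.1⟩, rfl⟩, hd⟩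
    obtain ⟨r, -, hr⟩ := List.mem_map.1 ht
    obtain ⟨-, -, rfl⟩ : r.1.1 = p.1 ∧ r.2.1 = _ ∧ r.2.2.1 = y := by simpa using hr
    exact ⟨r.2.2, _, ht, hd⟩
  · rintro ⟨p', f, ht, hd⟩
    exact ⟨f, ⟨_, ⟨ht, rfl⟩, rfl⟩, hd⟩

theorem mem_map_fst_rulePairs {p : A.H.State} :
    p.1 ∈ A.rulePairs.map Prod.fst ↔ A.HAccepting p := by
  simp [rulePairs, HAccepting, Subtype.ext_iff]

theorem advance_sublist_candidates : (A.advance G).Sublist A.candidates :=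
  (List.filter_sublist.map _).cons_cons _

theorem advance_mono {G' : List ℕ} (h : G ⊆ G') : A.advance G ⊆ A.advance G' := by
  intro x hx
  rw [mem_advance] at hx ⊢
  refine hx.imp_right ?_
  rintro ⟨p, hp, q, hq, hx⟩
  obtain ⟨r, hr, hG, rfl⟩ := mem_fired.1 hq
  exact ⟨p, h hp, _, mem_fired.2 ⟨r, hr, h hG, rfl⟩, hx⟩

theorem length_flatMap_candidates_le :
    (A.candidates.flatMap (encodeItem (α := α))).length ≤ A.encode.length := by
  have htrans : ((A.transTriples.map fun t => t.2.2).flatMap (encodeItem (α := α))).length ≤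
      (A.H.rules.flatMap fun r =>
        encodeItem r.1.1 ++ r.2.1.encode ++ [Sym.sep] ++ encodeItem r.2.2.1).length := by
    simp only [transTriples, List.map_map, List.flatMap_map, List.length_flatMap]
    exact List.sum_le_sum fun r _ => by simp only [Function.comp_apply, List.length_append]; omega
  simp only [candidates, List.flatMap_cons, AUTC.encode, List.length_append]
  omega

theorem advance_saturation_subset : A.advance A.saturation ⊆ A.saturation :=
  iterate_nil_subset (fun _ _ => advance_mono) (fun _ => advance_sublist_candidates.subset)
    ((length_le_length_flatMap (by simp [encodeItem]) _).trans length_flatMap_candidates_le)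

theorem exists_hAccessible_of_mem_saturation {x : ℕ} (hx : x ∈ A.saturation) :
    ∃ p : A.H.State, A.HAccessible p ∧ p.1 = x := by
  unfold saturation at hx
  generalize A.encode.length = n at hx
  induction n generalizing x with
  | zero => simp at hx
  | succ n ih =>
    have hG (p : A.H.State) (hp : p.1 ∈ A.advance^[n] []) : A.HAccessible p := by
      obtain ⟨p', hp', h⟩ := ih hp
      rwa [← Subtype.ext h]
    rw [Function.iterate_succ_apply', mem_advance] at hx
    obtain rfl | ⟨p, hp, q, hq, d, p', hread, rfl⟩ := hx
    · exact ⟨_, hAccessible_init, rfl⟩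
    · exact ⟨p', (hG p hp).read (targets_subset_vAccessible hG (mem_fired.1 hq)) hread, rfl⟩

theorem hAccessible_of_mem_saturation {p : A.H.State} (hp : p.1 ∈ A.saturation) :
    A.HAccessible p := by
  obtain ⟨p', hp', h⟩ := exists_hAccessible_of_mem_saturation hp
  rwa [← Subtype.ext h]

theorem language_eq_univ_iff_saturation : A.language = Set.univ ↔
    (∀ q ∈ A.fired A.saturation, q ∈ A.aut.finals) ∧
    ∀ x ∈ A.saturation, x ∈ A.rulePairs.map Prod.fst ∧
      ∀ q ∈ A.fired A.saturation, Covers (A.outFilters x) q := by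
  have hV {q : ℕ} (hq : q ∈ A.fired A.saturation) : A.VAccessible q :=
    targets_subset_vAccessible (fun _ => hAccessible_of_mem_saturation) (mem_fired.1 hq)
  constructor
  · refine fun hu => ⟨fun q hq => mem_finals_of_language_eq_univ hu (hV hq), fun x hx => ?_⟩
    obtain ⟨p, hp, rfl⟩ := exists_hAccessible_of_mem_saturation hx
    exact ⟨mem_map_fst_rulePairs.2 (hp.hAccepting_of_language_eq_univ hu), fun q hq =>
      covers_outFilters.2 fun d => hp.exists_reads_of_language_eq_univ hu d (hV hq)⟩
  · rintro ⟨hfinal, h⟩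
    have hclosed {x : ℕ} (hx : x ∈ A.advance A.saturation) : x ∈ A.saturation :=
      advance_saturation_subset hx
    refine language_eq_univ_of_closed (G := {p | p.1 ∈ A.saturation})
      (fun p hp d q hq p' hr =>
        hclosed (mem_advance.2 (.inr ⟨p, hp, q, mem_fired.2 hq, d, p', hr, rfl⟩)))
      (fun p hp d q hq => covers_outFilters.1 ((h _ hp).2 q (mem_fired.2 hq)) d)
      (hclosed (mem_advance.2 (.inl rfl)))
      (fun p hp => mem_map_fst_rulePairs.1 (h _ hp).1)
      fun q hq => hfinal q (mem_fired.2 hq)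

end AUTC

variable {α : Type} {P : Set (Pattern α)}

/-- A transition `p → p'` with filter `φ`, given by the names of its states, as it is written in
the encoding of an automaton. -/
def encodeTransition (t : ℕ × Filt P × ℕ) : List (Sym α) :=
  encodeItem t.1 ++ (t.2.1.encode ++ [Sym.sep] ++ encodeItem t.2.2)

/-- A rule `(p₀, p) → q`, given by the names of `p` and `q`, as it is written in the encoding of
an automaton. -/
def encodeRule (r : ℕ × ℕ) : List (Sym α) := encodeItem r.1 ++ encodeItem r.2

theorem AUTC.encode_eq (A : AUTC P) : A.encode =
    A.aut.states.flatMap encodeItem ++ Sym.close :: (A.aut.finals.flatMap encodeItem ++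
      Sym.close :: (A.H.states.flatMap encodeItem ++
        Sym.close :: (A.transTriples.flatMap encodeTransition ++
          Sym.close :: (encodeName A.p₀.1 ++
            Sym.sep :: (A.rulePairs.flatMap encodeRule ++ Sym.close :: []))))) := by
  have htrans : A.transTriples.flatMap encodeTransition = A.H.rules.flatMap fun r =>
      encodeItem r.1.1 ++ r.2.1.encode ++ [Sym.sep] ++ encodeItem r.2.2.1 := by
    rw [transTriples, List.flatMap_map]
    simp [encodeTransition]
  have hrules : A.rulePairs.flatMap (encodeRule (α := α)) =
      A.aut.rules.flatMap fun r => encodeItem r.1.1.2.1 ++ encodeItem r.2 := by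
    rw [rulePairs, List.flatMap_map]
    rfl
  rw [htrans, hrules, AUTC.encode]
  simp [encodeItem]

section

variable [Finite α] {O : Subroutine (Sym α)}

instance : Finite (Sym α) := by
  refine .of_surjective (fun x : Bool ⊕ α ⊕ Fin 9 => match x with
    | .inl b => Sym.bit b
    | .inr (.inl a) => Sym.letter a
    | .inr (.inr k) => ![.word, .cat, .alt, .star, .state, .and, .not, .sep, .close] k) ?_
  rintro (b | a | _)
  exacts [⟨.inl b, rfl⟩, ⟨.inr (.inl a), rfl⟩, ⟨.inr (.inr 0), rfl⟩, ⟨.inr (.inr 1), rfl⟩,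
    ⟨.inr (.inr 2), rfl⟩, ⟨.inr (.inr 3), rfl⟩, ⟨.inr (.inr 4), rfl⟩, ⟨.inr (.inr 5), rfl⟩,
    ⟨.inr (.inr 6), rfl⟩, ⟨.inr (.inr 7), rfl⟩, ⟨.inr (.inr 8), rfl⟩]

theorem selfDelimiting_encodeItem : SelfDelimiting O encodeItem :=
  .append_sep sep_notMem_encodeName

theorem selfDelimiting_filt : SelfDelimiting O fun f : Filt P => f.encode ++ [Sym.sep] :=
  .append_sep sep_notMem_encode_filt

theorem selfDelimiting_encodeRule : SelfDelimiting O encodeRule :=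
  selfDelimiting_encodeItem.append selfDelimiting_encodeItem

theorem selfDelimiting_encodeTransition :
    SelfDelimiting O (encodeTransition (P := P)) :=
  selfDelimiting_encodeItem.append (selfDelimiting_filt.append selfDelimiting_encodeItem)

variable {I K : Type} [Fintype K] [DecidableEq K] {e : I → K → List (Sym α)}

theorem polyTime_encodeItem {x : I → ℕ} :
    PolyTime O e (fun i => encodeItem (x i)) ↔ PolyTime O e fun i => encodeName (x i) :=
  ⟨fun h => PolyTime.before_sep (y := fun _ => []) h fun _ => sep_notMem_encodeName _,
    fun h => h.append (.const O e [Sym.sep])⟩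

theorem polyDec_mem {x : I → ℕ} {L : I → List ℕ} (hx : PolyTime O e fun i => encodeName (x i))
    (hL : PolyTime O e fun i => (L i).flatMap encodeItem) : PolyDec O e fun i => x i ∈ L i := by
  have heq : PolyDec O (fun y : I × ℕ => ext (encodeItem y.2) (e y.1))
      fun y => encodeName (x y.1) = encodeName (α := α) y.2 :=
    .eq Sym.sep ((hx.restrict Prod.fst).weaken _) (polyTime_encodeItem.1 (.var O _ none))
      fun _ => sep_notMem_encodeName _
  refine (PolyDec.exists_mem (p := fun i y => encodeName (x i) = encodeName (α := α) y)
    selfDelimiting_encodeItem hL heq).congr fun i => ?_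
  simp [encodeName_injective.eq_iff]

section Rule

variable {r : I → ℕ × ℕ} (h : PolyTime O e fun i => encodeRule (r i))
include h

theorem polyTime_rule_source : PolyTime O e fun i => encodeItem (r i).1 :=
  selfDelimiting_encodeItem.first h

theorem polyTime_rule_target : PolyTime O e fun i => encodeItem (r i).2 :=
  selfDelimiting_encodeItem.rest (b := fun i => (r i).1) h

end Rule

section Transition

variable {t : I → ℕ × Filt P × ℕ} (h : PolyTime O e fun i => encodeTransition (t i))
include h

theorem polyTime_transition_source : PolyTime O e fun i => encodeItem (t i).1 :=
  selfDelimiting_encodeItem.first h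

theorem polyTime_transition_filt : PolyTime O e fun i => (t i).2.1.encode ++ [Sym.sep] :=
  selfDelimiting_filt.first (selfDelimiting_encodeItem.rest (b := fun i => (t i).1) h)

theorem polyTime_transition_target : PolyTime O e fun i => encodeItem (t i).2.2 :=
  selfDelimiting_filt.rest (b := fun i => (t i).2.1)
    (selfDelimiting_encodeItem.rest (b := fun i => (t i).1) h)

end Transition

section Filters

variable (hvalid : PolyDec O (fun (f : Filt P) (_ : Unit) => f.encode) Filt.SingletonValid)
include hvalid

theorem polyDec_covers {fs : I → List (Filt P)} {q : I → ℕ}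
    (hfs : PolyTime O e fun i => (fs i).flatMap fun f => f.encode ++ [Sym.sep])
    (hq : PolyTime O e fun i => encodeName (q i)) : PolyDec O e fun i => Covers (fs i) (q i) := by
  have hfilt : PolyTime O (fun x : I × Filt P => ext (x.2.encode ++ [Sym.sep]) (e x.1))
      fun x => x.2.encode :=
    (PolyTime.var O _ none).before_sep (y := fun _ => []) fun x => sep_notMem_encode_filt x.2
  have havoid : PolyTime O e fun i => (avoid (fs i) (q i)).encode :=
    ((PolyTime.flatMap selfDelimiting_filt hfs ((hfilt.cons .not).cons .and)).append
      (hq.cons .state)).congr fun i => (encode_avoid _ _).symm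
  exact (hvalid.comp (c := fun i => .not (avoid (fs i) (q i))) (havoid.cons .not)).congr
    fun i => singletonValid_not_avoid

theorem polyDec_exists_sat {f : I → Filt P} {q : I → ℕ}
    (hf : PolyTime O e fun i => (f i).encode ++ [Sym.sep])
    (hq : PolyTime O e fun i => encodeName (q i)) :
    PolyDec O e fun i => ∃ d, (f i).Sat d {q i} := by
  refine (polyDec_covers hvalid (fs := fun i => [.not (f i)]) ?_ hq).not.congr
    fun i => exists_sat_iff_not_covers.symm
  exact (hf.cons .not).congr fun i => by simp [Filt.encode]

end Filters

namespace AUTC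

variable {A : I → AUTC P} {G : I → List ℕ} {x : I → ℕ}

section

variable (hA : PolyTime O e fun i => (A i).encode)
include hA

theorem polyTime_components : PolyTime O e (fun i => (A i).aut.finals.flatMap encodeItem) ∧
    PolyTime O e (fun i => (A i).transTriples.flatMap encodeTransition) ∧
    PolyTime O e (fun i => encodeName (A i).p₀.1) ∧
    PolyTime O e fun i => (A i).rulePairs.flatMap encodeRule := by
  have hitems (l : List ℕ) : (Sym.close : Sym α) ∉ l.flatMap encodeItem := by
    simp [close_notMem_encodeItem]
  have htransitions (l : List (ℕ × Filt P × ℕ)) : Sym.close ∉ l.flatMap encodeTransition := by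
    simp [encodeTransition, close_notMem_encodeItem, close_notMem_encode_filt]
  have hrules (l : List (ℕ × ℕ)) : (Sym.close : Sym α) ∉ l.flatMap encodeRule := by
    simp [encodeRule, close_notMem_encodeItem]
  have hfinals := (hA.congr fun i => (A i).encode_eq).after_sep fun i => hitems _
  have htrans := (hfinals.after_sep fun i => hitems _).after_sep fun i => hitems _
  have hinit := htrans.after_sep fun i => htransitions _
  exact ⟨hfinals.before_sep fun i => hitems _, htrans.before_sep fun i => htransitions _,
    hinit.before_sep fun i => sep_notMem_encodeName _,
    (hinit.after_sep fun i => sep_notMem_encodeName _).before_sep fun i => hrules _⟩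

theorem polyTime_fired (hG : PolyTime O e fun i => (G i).flatMap encodeItem) :
    PolyTime O e fun i => ((A i).fired (G i)).flatMap encodeItem := by
  obtain ⟨-, -, -, hrules⟩ := polyTime_components hA
  have hrule : PolyTime O (fun y : I × ℕ × ℕ => ext (encodeRule y.2) (e y.1))
      fun y => encodeRule y.2 := .var O _ none
  refine (PolyTime.flatMap_filter (p := fun i (r : ℕ × ℕ) => r.1 ∈ G i)
    (f := fun _ (r : ℕ × ℕ) => encodeItem r.2)
    selfDelimiting_encodeRule hrules (polyDec_mem ?_ ?_) (polyTime_rule_target hrule)).congr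
      fun i => by rw [fired, List.flatMap_map]
  · exact polyTime_encodeItem.1 (polyTime_rule_source hrule)
  · exact (hG.restrict Prod.fst).weaken _

theorem polyTime_outFilters (hx : PolyTime O e fun i => encodeName (x i)) :
    PolyTime O e fun i => ((A i).outFilters (x i)).flatMap fun f => f.encode ++ [Sym.sep] := by
  obtain ⟨-, htrans, -, -⟩ := polyTime_components hA
  have htransition : PolyTime O (fun y : I × ℕ × Filt P × ℕ => ext (encodeTransition y.2) (e y.1))
      fun y => encodeTransition y.2 := .var O _ none
  refine (PolyTime.flatMap_filter (p := fun i t => t.1 = x i)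
    (f := fun _ t => t.2.1.encode ++ [Sym.sep]) selfDelimiting_encodeTransition htrans
    ((PolyDec.eq Sym.sep (polyTime_encodeItem.1 (polyTime_transition_source htransition))
      ((hx.restrict Prod.fst).weaken _) fun _ => sep_notMem_encodeName _).congr fun y =>
        encodeName_injective.eq_iff) (polyTime_transition_filt htransition)).congr
      fun i => by rw [outFilters, List.flatMap_map]

theorem polyDec_accepting (hx : PolyTime O e fun i => encodeName (x i)) :
    PolyDec O e fun i => x i ∈ (A i).rulePairs.map Prod.fst := by
  obtain ⟨-, -, -, hrules⟩ := polyTime_components hA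
  refine polyDec_mem hx ((PolyTime.flatMap (f := fun _ (r : ℕ × ℕ) => encodeItem r.1)
    selfDelimiting_encodeRule hrules (polyTime_rule_source (.var O _ none))).congr fun i => ?_)
  rw [List.flatMap_map]

variable (hvalid : PolyDec O (fun (f : Filt P) (_ : Unit) => f.encode) Filt.SingletonValid)
include hvalid

theorem polyTime_advance (hG : PolyTime O e fun i => (G i).flatMap encodeItem) :
    PolyTime O e fun i => ((A i).advance (G i)).flatMap encodeItem := by
  classical
  obtain ⟨-, htrans, hinit, -⟩ := polyTime_components hA
  have htransition : PolyTime O (fun y : I × ℕ × Filt P × ℕ => ext (encodeTransition y.2) (e y.1))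
      fun y => encodeTransition y.2 := .var O _ none
  have hmem : PolyDec O (fun y : I × ℕ × Filt P × ℕ => ext (encodeTransition y.2) (e y.1))
      fun y => y.2.1 ∈ G y.1 :=
    polyDec_mem (polyTime_encodeItem.1 (polyTime_transition_source htransition))
      ((hG.restrict Prod.fst).weaken _)
  have hsat : PolyDec O (fun y : I × ℕ × Filt P × ℕ => ext (encodeTransition y.2) (e y.1))
      fun y => ∃ q ∈ (A y.1).fired (G y.1), ∃ d, y.2.2.1.Sat d {q} :=
    .exists_mem (p := fun (y : I × ℕ × Filt P × ℕ) (q : ℕ) => ∃ d, y.2.2.1.Sat d {q})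
      selfDelimiting_encodeItem
      (((polyTime_fired hA hG).restrict Prod.fst).weaken _)
      (polyDec_exists_sat hvalid
        (((polyTime_transition_filt htransition).restrict Prod.fst).weaken _)
        (polyTime_encodeItem.1 (.var O _ none)))
  refine ((polyTime_encodeItem.2 hinit).append (PolyTime.flatMap_filter
    (p := fun i (t : ℕ × Filt P × ℕ) =>
      t.1 ∈ G i ∧ ∃ q ∈ (A i).fired (G i), ∃ d, t.2.1.Sat d {q})
    (f := fun _ (t : ℕ × Filt P × ℕ) => encodeItem t.2.2)
    selfDelimiting_encodeTransition htrans (hmem.and hsat)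
    (polyTime_transition_target htransition))).congr fun i => ?_
  rw [advance, List.flatMap_cons, List.flatMap_map]

theorem polyTime_saturation : PolyTime O e fun i => (A i).saturation.flatMap encodeItem := by
  refine .iterate (c := fun l => l.flatMap encodeItem) (F := fun i => (A i).advance)
    (s := fun _ => []) hA .nil (polyTime_advance ((hA.restrict Prod.fst).weaken _) hvalid
      (.var O _ none)) hA.polyBounded_length fun i n hn => ?_
  cases n with
  | zero => exact Nat.zero_le _
  | succ n =>
    rw [Function.iterate_succ_apply']
    exact (advance_sublist_candidates.flatMap _).length_le.trans length_flatMap_candidates_le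

theorem polyDec_language_eq_univ : PolyDec O e fun i => (A i).language = Set.univ := by
  obtain ⟨hfinals, -, -, -⟩ := polyTime_components hA
  have hsat := polyTime_saturation hA hvalid
  have hfired := polyTime_fired hA hsat
  have hname : PolyTime O (fun y : I × ℕ => ext (encodeItem y.2) (e y.1))
      fun y => encodeName y.2 := polyTime_encodeItem.1 (.var O _ none)
  have hA' : PolyTime O (fun y : I × ℕ => ext (encodeItem y.2) (e y.1)) fun y => (A y.1).encode :=
    (hA.restrict Prod.fst).weaken _
  have hcovers : PolyDec O (fun y : I × ℕ => ext (encodeItem y.2) (e y.1))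
      fun y => ∀ q ∈ (A y.1).fired (A y.1).saturation, Covers ((A y.1).outFilters y.2) q :=
    .forall_mem (p := fun (y : I × ℕ) (q : ℕ) => Covers ((A y.1).outFilters y.2) q)
      selfDelimiting_encodeItem
      ((hfired.restrict Prod.fst).weaken _)
      (polyDec_covers hvalid (((polyTime_outFilters hA' hname).restrict Prod.fst).weaken _)
        (polyTime_encodeItem.1 (.var O _ none)))
  have hall : PolyDec O e fun i => ∀ x ∈ (A i).saturation, x ∈ (A i).rulePairs.map Prod.fst ∧
      ∀ q ∈ (A i).fired (A i).saturation, Covers ((A i).outFilters x) q :=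
    .forall_mem (p := fun i (x : ℕ) => x ∈ (A i).rulePairs.map Prod.fst ∧
      ∀ q ∈ (A i).fired (A i).saturation, Covers ((A i).outFilters x) q)
      selfDelimiting_encodeItem hsat ((polyDec_accepting hA' hname).and hcovers)
  have hfinal : PolyDec O e fun i => ∀ q ∈ (A i).fired (A i).saturation, q ∈ (A i).aut.finals :=
    .forall_mem (p := fun i (q : ℕ) => q ∈ (A i).aut.finals) selfDelimiting_encodeItem hfired
      (polyDec_mem hname ((hfinals.restrict Prod.fst).weaken _))
  exact (hfinal.and hall).congr fun i => language_eq_univ_iff_saturation.symm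

end

end AUTC

end

theorem AUTC.decidableInPTime_language_eq_univ {α : Type} [Finite α] {P : Set (Pattern α)}
    (hP : DecidableInPTime (Filt.encode (P := P)) Filt.SingletonValid) :
    DecidableInPTime (AUTC.encode (P := P)) fun A => A.language = Set.univ := by
  obtain ⟨h⟩ := hP
  have hsymbol : Function.Injective (subroutine h Sym.bit).symbol := by
    rw [subroutine_symbol]
    exact fun _ _ => Sym.bit.inj
  classical
  have hvalid : PolyDec (subroutine h Sym.bit) (fun (f : Filt P) (_ : Unit) => f.encode)
      Filt.SingletonValid :=
    (PolyDec.call (.var _ _ ()) (exists_subroutine_answers h Sym.bit) hsymbol).congr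
      fun f => by simp
  exact (polyDec_language_eq_univ (.var _ (fun (A : AUTC P) (_ : Unit) => A.encode) ()) hvalid)
    |>.nonempty_computableInPolyTime

end DataTree

theorem mainTheorem3 {α : Type} [Fintype α] (P : Set (DataTree.Pattern α))
    (hP : DataTree.DecidableInPTime (DataTree.Filt.encode (P := P))
      (fun f : DataTree.Filt P => f.SingletonValid)) :
    DataTree.DecidableInPTime (DataTree.AUTC.encode (P := P))
      (fun A : DataTree.AUTC P => A.language = Set.univ) ∧
    ∀ A : DataTree.AUTC P, A.language = Set.univ ↔
      (∀ q : ℕ, A.VAccessible q → q ∈ A.aut.finals) ∧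
      (∀ p : A.H.State, A.HAccessible p → A.HAccepting p) ∧
      (∀ p : A.H.State, A.HAccessible p → ∀ (d : List α) (q : ℕ), A.VAccessible q →
        ∃ p' : A.H.State, A.H.Reads p d {q} p') :=
  ⟨DataTree.AUTC.decidableInPTime_language_eq_univ hP, DataTree.AUTC.language_eq_univ_iff⟩
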